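/- Let $V_l,V_m,V_r:\mathbb{R}\to\mathbb{R}$ be $C^3$ functions. For $L>0$ put $V(u,x)=V_l(u)$ for $x<-L$, $V(u,x)=V_m(u)$ for $|x|<L$ and $V(u,x)=V_r(u)$ for $x>L$. A stationary front of $u_{tt}=u_{xx}+\frac{\partial}{\partial u}V(u,x)-\alpha u_t$ (with $\alpha\ge0$) with middle interval $(-L,L)$ is a $C^1$ function $u$ on $\mathbb{R}$ that satisfies $0=u_{xx}+\frac{\partial}{\partial u}V(u,x)$ on each of $(-\infty,-L)$, $(-L,L)$, $(L,\infty)$ and for which $u_x(x)\to0$ exponentially fast as $x\to\pm\infty$. Let $G\subset\mathbb{R}$ be open, let $L:G\to(0,\infty)$ be $C^1$, and for each $g\in G$ let $u_{\rm f}(\cdot;g)$ be a stationary front with middle interval $(-L(g),L(g))$, such that $\frac12(u_{\rm f})_x^2+V_m(u_{\rm f})=g$ on this interval, the limits of $u_{\rm f}(x;g)$ as $x\to\pm\infty$ do not depend on $g$, and $u_l(g)=u_{\rm f}(-L(g);g)$, $p_l(g)=(u_{\rm f})_x(-L(g);g)$, $u_r(g)=u_{\rm f}(L(g);g)$, $p_r(g)=(u_{\rm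 f})_x(L(g);g)$ are continuous in $g$. (So $L$ is a smooth length curve of fronts, parametrised by the Hamiltonian $g$ of the middle interval.) Put \[ \mathscr{B}_l(g)=p_l(g)\,[V_m'(u_l(g))-V_l'(u_l(g))],\qquad \mathscr{B}_r(g)=p_r(g)\,[V_r'(u_r(g))-V_m'(u_r(g))], \] and let $\Pi(g)=1$ if $(u_{\rm f})_x(x;g)\,(u_{\rm f})_x(-x;g)>0$ for all large $x$, $\Pi(g)=-1$ if this product is negative for all large $x$, and $\Pi(g)=0$ otherwise. Let $g\in G$ be such that all zeroes of $(u_{\rm f})_x(\cdot;g)$ (away from $x=\pm L(g)$) are simple. If \[ \Pi(g)\,\mathscr{B}_l(g)\,\mathscr{B}_r(g)\,L'(g)>0, \] then the front $u_{\rm f}(\cdot;g)$ is linearly unstable, i.e. the linearisation operator $\mathcal{L}(g)=D_{xx}+\frac{\partial^2V}{\partial u^2}(u_{\rm f}(x;g),x)$ on $L^2(\mathbb{R})$ with domain $H^2(\mathbb{R})$ has an eigenvalue $\Lambda>0$. -/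

import Mathlib

open MeasureTheory Filter Topology Set
open scoped ContDiff

noncomputable section

/-- A potential consisting of three `C³` functions: `Vl` is used on the left interval `(-∞, -L)`,
`Vm` on the middle interval `(-L, L)` and `Vr` on the right interval `(L, ∞)`. -/
structure PiecewisePotential where
  Vl : ℝ → ℝ
  Vm : ℝ → ℝ
  Vr : ℝ → ℝ
  contDiff_l : ContDiff ℝ 3 Vl
  contDiff_m : ContDiff ℝ 3 Vm
  contDiff_r : ContDiff ℝ 3 Vr

namespace PiecewisePotential

/-- The inhomogeneous potential `V(u, x)` whose middle interval is `(-L, L)`. The values at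
`x = ± L` are immaterial: they are never used below. -/
def val (V : PiecewisePotential) (L : ℝ) (w x : ℝ) : ℝ :=
  if x < -L then V.Vl w else if x ≤ L then V.Vm w else V.Vr w

/-- `∂V/∂u (w, x)`. -/
def du (V : PiecewisePotential) (L : ℝ) (w x : ℝ) : ℝ :=
  deriv (fun v => V.val L v x) w

/-- `∂²V/∂u² (w, x)`. -/
def duu (V : PiecewisePotential) (L : ℝ) (w x : ℝ) : ℝ :=
  iteratedDeriv 2 (fun v => V.val L v x) w

end PiecewisePotential

/-- `u` is a stationary front (or solitary wave) of
`u_tt = u_xx + ∂V/∂u (u, x) - α u_t` with middle interval `(-L, L)`: a `C¹` function on `ℝ` that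
solves `0 = u_xx + ∂V/∂u (u, x)` on the three open intervals, whose derivative tends to `0`
exponentially fast at `± ∞`, and with limits `um` at `-∞` and `up` at `+∞`. -/
structure IsStationaryFront (V : PiecewisePotential) (L : ℝ) (um up : ℝ) (u : ℝ → ℝ) : Prop where
  contDiff : ContDiff ℝ 1 u
  ode : ∀ x, x ≠ -L → x ≠ L → HasDerivAt (deriv u) (-(V.du L (u x) x)) x
  decay : ∃ C κ : ℝ, 0 < κ ∧ ∀ x, |deriv u x| ≤ C * Real.exp (-κ * |x|)
  tendsto_atBot : Tendsto u atBot (𝓝 um)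
  tendsto_atTop : Tendsto u atTop (𝓝 up)

/-- `L : G → (0, ∞)` is a smooth length curve with fronts `uf g`, `g ∈ G`: for every `g` in the
open set `G`, the function `uf g` is a stationary front whose middle interval is `(-L g, L g)`
and on whose middle interval the Hamiltonian `p² / 2 + V_m(u)` (with `p = u_x`) equals `g`;
the steady states `um`, `up` do not depend on `g`; `L` is `C¹`; and the values of `u` and `p` at
both ends of the middle interval are continuous (so single-valued) functions of `g`. -/
structure IsLengthCurve (V : PiecewisePotential) (um up : ℝ) (G : Set ℝ) (L : ℝ → ℝ)
    (uf : ℝ → ℝ → ℝ) : Prop where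
  isOpen : IsOpen G
  contDiffOn : ContDiffOn ℝ 1 L G
  pos : ∀ g ∈ G, 0 < L g
  front : ∀ g ∈ G, IsStationaryFront V (L g) um up (uf g)
  hamiltonian : ∀ g ∈ G, ∀ x ∈ Ioo (-(L g)) (L g),
    (deriv (uf g) x) ^ 2 / 2 + V.Vm (uf g x) = g
  continuousOn_ul : ContinuousOn (fun g => uf g (-(L g))) G
  continuousOn_pl : ContinuousOn (fun g => deriv (uf g) (-(L g))) G
  continuousOn_ur : ContinuousOn (fun g => uf g (L g)) G
  continuousOn_pr : ContinuousOn (fun g => deriv (uf g) (L g)) G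

/-- All zeroes of `u_x` are simple (`u_xx` exists away from the two points `± L`). -/
def HasSimpleDerivZeros (L : ℝ) (u : ℝ → ℝ) : Prop :=
  ∀ x, x ≠ -L → x ≠ L → deriv u x = 0 → deriv (deriv u) x ≠ 0

/-- The left bifurcation function `p_l [V_m'(u_l) - V_l'(u_l)]`, where `u_l = u(-L)` and
`p_l = u_x(-L)`. -/
def bifLeft (V : PiecewisePotential) (L : ℝ) (u : ℝ → ℝ) : ℝ :=
  deriv u (-L) * (deriv V.Vm (u (-L)) - deriv V.Vl (u (-L)))

/-- The right bifurcation function `p_r [V_r'(u_r) - V_m'(u_r)]`, where `u_r = u(L)` and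
`p_r = u_x(L)`. -/
def bifRight (V : PiecewisePotential) (L : ℝ) (u : ℝ → ℝ) : ℝ :=
  deriv u L * (deriv V.Vr (u L) - deriv V.Vm (u L))

open Classical in
/-- The sign `Π`: it is `1` if `u_x` has the same (nonzero) sign near `+∞` and near `-∞`, it is
`-1` if the signs are opposite, and `0` if neither is the case. -/
def asymptoticSign (u : ℝ → ℝ) : ℝ :=
  if ∀ᶠ x in atTop, 0 < deriv u x * deriv u (-x) then 1
  else if ∀ᶠ x in atTop, deriv u x * deriv u (-x) < 0 then -1
  else 0

/-- `f'` is a weak derivative of `f` on the real line. -/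
def IsWeakDeriv (f f' : ℝ → ℝ) : Prop :=
  ∀ φ : ℝ → ℝ, ContDiff ℝ ∞ φ → HasCompactSupport φ →
    ∫ x, f x * deriv φ x = -∫ x, f' x * φ x

/-- `Λ` is an eigenvalue of the linearisation operator
`D_xx + ∂²V/∂u² (u(x), x)` with domain `H²(ℝ)`: some `Ψ ∈ H²(ℝ)` that is not (almost everywhere)
zero, with weak derivatives `Ψ₁` and `Ψ₂` of order one and two in `L²(ℝ)`, satisfies
`Ψ₂ + ∂²V/∂u² (u(x), x) Ψ = Λ Ψ`. -/
def IsLinearisationEigenvalue (V : PiecewisePotential) (L : ℝ) (u : ℝ → ℝ) (Λ : ℝ) : Prop :=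
  ∃ Ψ Ψ₁ Ψ₂ : ℝ → ℝ,
    MemLp Ψ 2 ∧ MemLp Ψ₁ 2 ∧ MemLp Ψ₂ 2 ∧
    IsWeakDeriv Ψ Ψ₁ ∧ IsWeakDeriv Ψ₁ Ψ₂ ∧
    ¬ (Ψ =ᵐ[volume] 0) ∧
    ∀ᵐ x, Ψ₂ x + V.duu L (u x) x * Ψ x = Λ * Ψ x

end

/-!
Linearise about a front `u`, and let `F` and `K` be the solutions of `w_xx + V_uu(u, x) w = l w`
that decay at `+∞` and at `-∞`, normalised to be positive there. Their Wronskian `W(l)` does not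
depend on `x`, is continuous in `l ≥ 0`, and is negative once `l > sup V_uu`; a zero `l > 0` of `W`
makes `F` and `K` proportional, hence an eigenfunction. So it is enough that `W(0) > 0`.

At `l = 0`, `F` is a multiple of `u_x` on `(L, ∞)` and `K` is one on `(-∞, -L)`. Along the length
curve `(u_l, p_l)` stays on a fixed orbit of the left system and `(u_r, p_r)` on one of the right
system, so conservation of energy shows that their `g`-derivatives are `1 / B_l` and `-1 / B_r`
times the tangent vectors of these orbits. The flow of the middle system carries `(u_l, p_l)` to
`(u_r, p_r)` in time `2 L(g)`, and its linearisation preserves the symplectic form `du ∧ dp`. Pair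
the `g`-derivative of this relation with the continuation of `K` into the middle interval: at `-L`
the form vanishes, since there `K` is tangent to the left orbit, and the resulting identity at `L`
says that, up to a positive factor, `W(0)` is `Π B_l B_r L'`.
-/

noncomputable section

theorem hasDerivAt_exp_mul (c x : ℝ) :
    HasDerivAt (fun x => Real.exp (c * x)) (c * Real.exp (c * x)) x := by
  simpa [mul_comm] using ((hasDerivAt_id x).const_mul c).exp

theorem tendsto_mul_exp_neg_mul_atTop (C : ℝ) {κ : ℝ} (hκ : 0 < κ) :
    Tendsto (fun x => C * Real.exp (-κ * x)) atTop (𝓝 0) := by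
  simpa using (Real.tendsto_exp_atBot.comp
    (tendsto_id.const_mul_atTop_of_neg (neg_lt_zero.2 hκ))).const_mul C

theorem hasDerivAt_comp_neg {F : ℝ → ℝ} {d x : ℝ} (h : HasDerivAt F d (-x)) :
    HasDerivAt (fun y => F (-y)) (-d) x :=
  (h.comp x (hasDerivAt_neg x)).congr_deriv (by ring)

section OffCountable

variable {F F' : ℝ → ℝ} {S : Set ℝ}

theorem hasDerivAt_of_hasDerivAt_off_countable (hS : S.Countable) (hF : Continuous F)
    (hF' : Continuous F') (hd : ∀ x ∉ S, HasDerivAt F (F' x) x) (x : ℝ) :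
    HasDerivAt F (F' x) x := by
  have hprim : F = fun y => F x + ∫ t in x..y, F' t := by
    ext y
    rw [integral_eq_of_hasDerivAt_off_countable F F' hS hF.continuousOn (fun z hz => hd z hz.2)
      (hF'.intervalIntegrable _ _)]
    ring
  rw [hprim]
  exact (intervalIntegral.integral_hasDerivAt_right (hF'.intervalIntegrable _ _)
    (hF'.stronglyMeasurableAtFilter _ _) hF'.continuousAt).const_add (F x)

theorem monotone_of_hasDerivAt_off_countable (hS : S.Countable) (hF : Continuous F)
    (hd : ∀ x ∉ S, HasDerivAt F (F' x) x) (hi : ∀ a b, IntervalIntegrable F' volume a b)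
    (hF' : ∀ x, 0 ≤ F' x) : Monotone F := by
  intro a b hab
  rw [← sub_nonneg, ← integral_eq_of_hasDerivAt_off_countable F F' hS hF.continuousOn
    (fun z hz => hd z hz.2) (hi a b)]
  exact intervalIntegral.integral_nonneg hab fun x _ => hF' x

theorem eq_of_hasDerivAt_zero_off_countable {a b : ℝ} (hS : S.Countable)
    (hF : ContinuousOn F (uIcc a b))
    (hd : ∀ x ∈ Ioo (min a b) (max a b) \ S, HasDerivAt F 0 x) : F a = F b := by
  have h := integral_eq_of_hasDerivAt_off_countable F (fun _ => 0) hS hF hd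
    intervalIntegrable_const
  rwa [intervalIntegral.integral_zero, eq_comm, sub_eq_zero, eq_comm] at h

end OffCountable

section IntegralIoi

variable {g : ℝ → ℝ}

theorem integral_Ioi_eq_sub_intervalIntegral (hg : ∀ x, IntegrableOn g (Ioi x)) (x : ℝ) :
    ∫ s in Ioi x, g s = (∫ s in Ioi 0, g s) - ∫ s in (0 : ℝ)..x, g s := by
  rw [← intervalIntegral.integral_Ioi_sub_Ioi' (hg 0) (hg x), sub_sub_cancel]

theorem intervalIntegrable_of_integrableOn_Ioi (hg : ∀ x, IntegrableOn g (Ioi x)) (a b : ℝ) :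
    IntervalIntegrable g volume a b :=
  intervalIntegrable_iff.2 ((hg (min a b)).mono_set fun _ hx => hx.1)

theorem continuous_integral_Ioi (hg : ∀ x, IntegrableOn g (Ioi x)) :
    Continuous fun x => ∫ s in Ioi x, g s := by
  rw [funext (integral_Ioi_eq_sub_intervalIntegral hg)]
  exact continuous_const.sub
    (intervalIntegral.continuous_primitive (intervalIntegrable_of_integrableOn_Ioi hg) 0)

theorem hasDerivAt_integral_Ioi (hm : Measurable g) (hg : ∀ x, IntegrableOn g (Ioi x)) {x : ℝ}
    (hx : ContinuousAt g x) : HasDerivAt (fun x => ∫ s in Ioi x, g s) (-g x) x := by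
  rw [funext (integral_Ioi_eq_sub_intervalIntegral hg)]
  exact (intervalIntegral.integral_hasDerivAt_right (intervalIntegrable_of_integrableOn_Ioi hg 0 x)
    hm.stronglyMeasurable.stronglyMeasurableAtFilter hx).const_sub _

theorem integral_Ioi_exp_mul_sub (c x : ℝ) :
    ∫ s in Ioi x, Real.exp (-c * (s - x)) * g s =
      Real.exp (c * x) * ∫ s in Ioi x, Real.exp (-c * s) * g s := by
  rw [← integral_const_mul]
  congr 1; ext s
  rw [← mul_assoc, ← Real.exp_add]
  ring_nf

theorem continuous_integral_Ioi_exp_mul_sub {c : ℝ}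
    (hg : ∀ x, IntegrableOn (fun s => Real.exp (-c * s) * g s) (Ioi x)) :
    Continuous fun x => ∫ s in Ioi x, Real.exp (-c * (s - x)) * g s := by
  rw [funext (integral_Ioi_exp_mul_sub c)]
  exact (by fun_prop : Continuous fun x => Real.exp (c * x)).mul (continuous_integral_Ioi hg)

theorem hasDerivAt_integral_Ioi_exp_mul_sub {c : ℝ} (hm : Measurable g)
    (hg : ∀ x, IntegrableOn (fun s => Real.exp (-c * s) * g s) (Ioi x)) {x : ℝ}
    (hx : ContinuousAt g x) :
    HasDerivAt (fun x => ∫ s in Ioi x, Real.exp (-c * (s - x)) * g s)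
      (c * (∫ s in Ioi x, Real.exp (-c * (s - x)) * g s) - g x) x := by
  have hcont : Continuous fun s => Real.exp (-c * s) := by fun_prop
  have hexp : Real.exp (c * x) * Real.exp (-c * x) = 1 := by
    rw [← Real.exp_add, neg_mul, add_neg_cancel, Real.exp_zero]
  rw [funext (integral_Ioi_exp_mul_sub c)]
  refine ((hasDerivAt_exp_mul c x).mul (hasDerivAt_integral_Ioi (hcont.measurable.mul hm) hg
    (hcont.continuousAt.mul hx))).congr_deriv ?_
  simp only [integral_Ioi_exp_mul_sub, Pi.mul_apply]
  linear_combination -g x * hexp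

end IntegralIoi

/-! ### Jost solutions -/

/-- The kernel `(1 - e^{-2 m t}) / (2 m)` of the Volterra equation
`v x = 1 + ∫ s in Ioi x, (1 - e^{-2 m (s - x)}) / (2 m) * (r s * v s)`, which a solution
`e^{-m x} v` of `y'' = (m² + r) y` satisfies when `v → 1` at `+∞`. It is extended by `0` to
negative `t`, so that integrals over `(x, ∞)` become integrals over `ℝ`. -/
def jostKernel (m t : ℝ) : ℝ := (1 - Real.exp (-(2 * m) * max t 0)) / (2 * m)

theorem jostKernel_nonneg {m : ℝ} (hm : 0 < m) (t : ℝ) : 0 ≤ jostKernel m t := by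
  have hexp : Real.exp (-(2 * m) * max t 0) ≤ 1 := by
    rw [Real.exp_le_one_iff]
    nlinarith [le_max_right t 0]
  exact div_nonneg (sub_nonneg.2 hexp) (by positivity)

theorem jostKernel_le {m₀ m : ℝ} (hm₀ : 0 < m₀) (hm : m₀ ≤ m) (t : ℝ) :
    jostKernel m t ≤ 1 / (2 * m₀) := by
  refine div_le_div₀ zero_le_one ?_ (by positivity) (by gcongr)
  linarith [Real.exp_pos (-(2 * m) * max t 0)]

theorem jostKernel_of_nonpos {m t : ℝ} (ht : t ≤ 0) : jostKernel m t = 0 := by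
  simp [jostKernel, max_eq_right ht]

theorem jostKernel_of_nonneg {m t : ℝ} (ht : 0 ≤ t) :
    jostKernel m t = (1 - Real.exp (-(2 * m) * t)) / (2 * m) := by
  simp [jostKernel, max_eq_left ht]

/-- The integral part of the Volterra equation for the Jost solutions. -/
def jostIntegral (r : ℝ → ℝ) (m : ℝ) (g : ℝ → ℝ) (x : ℝ) : ℝ :=
  ∫ s, jostKernel m (s - x) * (r s * g s)

/-- The weight in the norm `sup |v| / w` for which the Volterra operator is a contraction on the
whole line: `w = exp (C / (κ μ₀) e^{-κ x})`. -/
def jostWeight (C κ μ₀ x : ℝ) : ℝ := Real.exp (C / (κ * μ₀) * Real.exp (-κ * x))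

/-- The density `C e^{-κ x} w(x) = -μ₀ w'(x)`, which dominates `|r| w` if `|r x| ≤ C e^{-κ x}`. -/
def jostDensity (C κ μ₀ x : ℝ) : ℝ := C * Real.exp (-κ * x) * jostWeight C κ μ₀ x

theorem continuous_jostWeight (C κ μ₀ : ℝ) : Continuous (jostWeight C κ μ₀) := by
  unfold jostWeight; fun_prop

theorem jostWeight_pos (C κ μ₀ x : ℝ) : 0 < jostWeight C κ μ₀ x := Real.exp_pos _

theorem abs_jostWeight_mul_le {C κ μ₀ : ℝ} (b : BoundedContinuousFunction (ℝ × ℝ) ℝ) (l x : ℝ) :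
    |jostWeight C κ μ₀ x * b (l, x)| ≤ ‖b‖ * jostWeight C κ μ₀ x := by
  rw [abs_mul, abs_of_pos (jostWeight_pos C κ μ₀ x), mul_comm]
  exact mul_le_mul_of_nonneg_right (b.norm_coe_le_norm _) (jostWeight_pos C κ μ₀ x).le

/-- The data for a family of Jost solutions: an exponentially small perturbation `r` and a
continuous family of exponents `μ l`, bounded from below by `μ₀ > 0`, for the equations
`y'' = (μ l ^ 2 + r) y`. -/
structure JostData (r μ : ℝ → ℝ) (C κ μ₀ : ℝ) : Prop where
  measurable : Measurable r
  bound : ∀ s, |r s| ≤ C * Real.exp (-κ * s)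
  C_pos : 0 < C
  κ_pos : 0 < κ
  μ₀_pos : 0 < μ₀
  continuous_μ : Continuous μ
  le_μ : ∀ l, μ₀ ≤ μ l

namespace JostData

variable {r μ : ℝ → ℝ} {C κ μ₀ : ℝ}

theorem μ_pos (h : JostData r μ C κ μ₀) (l : ℝ) : 0 < μ l := h.μ₀_pos.trans_le (h.le_μ l)

theorem one_le_weight (h : JostData r μ C κ μ₀) (x : ℝ) : 1 ≤ jostWeight C κ μ₀ x := by
  have := h.C_pos; have := h.κ_pos; have := h.μ₀_pos
  rw [jostWeight, Real.one_le_exp_iff]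
  positivity

theorem weight_antitone (h : JostData r μ C κ μ₀) : Antitone (jostWeight C κ μ₀) := by
  intro x y hxy
  have := h.C_pos; have := h.κ_pos; have := h.μ₀_pos
  have hexp : Real.exp (-κ * y) ≤ Real.exp (-κ * x) := Real.exp_le_exp.2 (by nlinarith)
  unfold jostWeight
  gcongr

theorem density_nonneg (h : JostData r μ C κ μ₀) (x : ℝ) : 0 ≤ jostDensity C κ μ₀ x :=
  mul_nonneg (mul_nonneg h.C_pos.le (Real.exp_pos _).le) (jostWeight_pos C κ μ₀ x).le

theorem hasDerivAt_weight (h : JostData r μ C κ μ₀) (x : ℝ) :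
    HasDerivAt (fun s => -μ₀ * jostWeight C κ μ₀ s) (jostDensity C κ μ₀ x) x := by
  have := h.κ_pos.ne'; have := h.μ₀_pos.ne'
  refine ((((hasDerivAt_exp_mul (-κ) x).const_mul (C / (κ * μ₀))).exp).const_mul
    (-μ₀)).congr_deriv ?_
  unfold jostDensity jostWeight
  field_simp

theorem tendsto_weight (h : JostData r μ C κ μ₀) :
    Tendsto (jostWeight C κ μ₀) atTop (𝓝 1) := by
  rw [← Real.exp_zero]
  exact (tendsto_mul_exp_neg_mul_atTop (C / (κ * μ₀)) h.κ_pos).rexp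

theorem integrableOn_density (h : JostData r μ C κ μ₀) (x : ℝ) :
    IntegrableOn (jostDensity C κ μ₀) (Ioi x) :=
  integrableOn_Ioi_deriv_of_nonneg' (fun y _ => h.hasDerivAt_weight y)
    (fun y _ => h.density_nonneg y) (h.tendsto_weight.const_mul (-μ₀))

theorem integral_density (h : JostData r μ C κ μ₀) (x : ℝ) :
    ∫ s in Ioi x, jostDensity C κ μ₀ s = μ₀ * (jostWeight C κ μ₀ x - 1) := by
  rw [integral_Ioi_of_hasDerivAt_of_nonneg' (fun y _ => h.hasDerivAt_weight y)
    (fun y _ => h.density_nonneg y) (h.tendsto_weight.const_mul (-μ₀))]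
  ring

theorem abs_mul_le (h : JostData r μ C κ μ₀) {y M s : ℝ} (hy : |y| ≤ M * jostWeight C κ μ₀ s) :
    |r s * y| ≤ M * jostDensity C κ μ₀ s := by
  calc |r s * y| = |r s| * |y| := abs_mul _ _
    _ ≤ (C * Real.exp (-κ * s)) * (M * jostWeight C κ μ₀ s) :=
        mul_le_mul (h.bound s) hy (abs_nonneg y) ((abs_nonneg _).trans (h.bound s))
    _ = M * jostDensity C κ μ₀ s := by unfold jostDensity; ring

theorem abs_kernel_mul_le (h : JostData r μ C κ μ₀) {y M s : ℝ} (l x : ℝ)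
    (hy : |y| ≤ M * jostWeight C κ μ₀ s) :
    |jostKernel (μ l) (s - x) * (r s * y)| ≤
      (Ioi x).indicator (fun s => M / (2 * μ₀) * jostDensity C κ μ₀ s) s := by
  have hμ₀ := h.μ₀_pos
  by_cases hs : s ∈ Ioi x
  · rw [indicator_of_mem hs, abs_mul, abs_of_nonneg (jostKernel_nonneg (h.μ_pos l) _)]
    calc jostKernel (μ l) (s - x) * |r s * y| ≤ 1 / (2 * μ₀) * (M * jostDensity C κ μ₀ s) :=
          mul_le_mul (jostKernel_le hμ₀ (h.le_μ l) _) (h.abs_mul_le hy) (abs_nonneg _)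
            (by positivity)
      _ = M / (2 * μ₀) * jostDensity C κ μ₀ s := by ring
  · rw [indicator_of_notMem hs, jostKernel_of_nonpos (by simpa using hs), zero_mul, abs_zero]

theorem integrable_bound (h : JostData r μ C κ μ₀) (M x : ℝ) :
    Integrable ((Ioi x).indicator (fun s => M / (2 * μ₀) * jostDensity C κ μ₀ s)) :=
  IntegrableOn.integrable_indicator ((h.integrableOn_density x).const_mul _) measurableSet_Ioi

theorem integral_bound (h : JostData r μ C κ μ₀) (M x : ℝ) :
    ∫ s, (Ioi x).indicator (fun s => M / (2 * μ₀) * jostDensity C κ μ₀ s) s =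
      M / 2 * (jostWeight C κ μ₀ x - 1) := by
  have := h.μ₀_pos.ne'
  rw [integral_indicator measurableSet_Ioi, integral_const_mul, h.integral_density]
  field_simp

theorem measurable_integrand (h : JostData r μ C κ μ₀) {v : ℝ → ℝ} (hv : Continuous v) (l x : ℝ) :
    Measurable fun s => jostKernel (μ l) (s - x) * (r s * v s) := by
  have hker : Continuous fun s => jostKernel (μ l) (s - x) := by unfold jostKernel; fun_prop
  exact hker.measurable.mul (h.measurable.mul hv.measurable)

theorem integrable_integrand (h : JostData r μ C κ μ₀) {v : ℝ → ℝ} (hv : Continuous v) {M : ℝ}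
    (hM : ∀ s, |v s| ≤ M * jostWeight C κ μ₀ s) (l x : ℝ) :
    Integrable fun s => jostKernel (μ l) (s - x) * (r s * v s) :=
  (h.integrable_bound M x).mono' (h.measurable_integrand hv l x).aestronglyMeasurable
    (Eventually.of_forall fun s => h.abs_kernel_mul_le l x (hM s))

theorem abs_jostIntegral_le (h : JostData r μ C κ μ₀) {v : ℝ → ℝ} {M : ℝ}
    (hM : ∀ s, |v s| ≤ M * jostWeight C κ μ₀ s) (l x : ℝ) :
    |jostIntegral r (μ l) v x| ≤ M / 2 * (jostWeight C κ μ₀ x - 1) := by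
  rw [← h.integral_bound, ← Real.norm_eq_abs]
  exact norm_integral_le_of_norm_le (h.integrable_bound M x)
    (Eventually.of_forall fun s => h.abs_kernel_mul_le l x (hM s))

theorem continuous_kernel (h : JostData r μ C κ μ₀) (s : ℝ) :
    Continuous fun p : ℝ × ℝ => jostKernel (μ p.1) (s - p.2) := by
  have := h.continuous_μ
  exact Continuous.div (by fun_prop) (by fun_prop) fun p =>
    mul_ne_zero two_ne_zero (h.μ_pos p.1).ne'

theorem continuous_jostIntegral (h : JostData r μ C κ μ₀) {v : ℝ → ℝ → ℝ}
    (hv : Continuous fun p : ℝ × ℝ => v p.1 p.2) {M : ℝ}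
    (hM : ∀ l s, |v l s| ≤ M * jostWeight C κ μ₀ s) :
    Continuous fun p : ℝ × ℝ => jostIntegral r (μ p.1) (v p.1) p.2 := by
  have hM0 : 0 ≤ M := nonneg_of_mul_nonneg_left ((abs_nonneg _).trans (hM 0 0))
    (jostWeight_pos C κ μ₀ 0)
  refine continuous_iff_continuousAt.2 fun ⟨l₀, x₀⟩ => continuousAt_of_dominated
    (bound := (Ioi (x₀ - 1)).indicator (fun s => M / (2 * μ₀) * jostDensity C κ μ₀ s)) ?_ ?_
    (h.integrable_bound M _) ?_
  · exact Eventually.of_forall fun p => (h.measurable_integrand (v := v p.1)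
      (hv.comp (Continuous.prodMk_right p.1)) p.1 p.2).aestronglyMeasurable
  · have hnear : ∀ᶠ p : ℝ × ℝ in 𝓝 (l₀, x₀), x₀ - 1 < p.2 :=
      continuous_snd.continuousAt.eventually (lt_mem_nhds (sub_one_lt x₀))
    filter_upwards [hnear] with p hp
    refine Eventually.of_forall fun s => (h.abs_kernel_mul_le p.1 p.2 (hM p.1 s)).trans ?_
    refine indicator_le_indicator_of_subset (Ioi_subset_Ioi hp.le) (fun s => ?_) s
    exact mul_nonneg (div_nonneg hM0 (mul_pos two_pos h.μ₀_pos).le) (h.density_nonneg s)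
  · exact Eventually.of_forall fun s => ((h.continuous_kernel s).mul
      (continuous_const.mul (hv.comp (continuous_fst.prodMk continuous_const)))).continuousAt

theorem abs_one_add_jostIntegral_le (h : JostData r μ C κ μ₀)
    (b : BoundedContinuousFunction (ℝ × ℝ) ℝ) (l x : ℝ) :
    |(jostWeight C κ μ₀ x)⁻¹ *
      (1 + jostIntegral r (μ l) (fun s => jostWeight C κ μ₀ s * b (l, s)) x)| ≤ 1 + ‖b‖ / 2 := by
  have hw := jostWeight_pos C κ μ₀ x
  have hint := h.abs_jostIntegral_le (abs_jostWeight_mul_le b l) l x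
  rw [abs_mul, abs_inv, abs_of_pos hw, inv_mul_le_iff₀ hw]
  refine (abs_add_le _ _).trans ?_
  rw [abs_one]
  linarith [h.one_le_weight x, norm_nonneg b]

/-- The Volterra operator `v ↦ 1 + jostIntegral r (μ l) (v l)`, conjugated with the weight so that
it acts on bounded continuous functions of `(l, x)`. -/
def operator (h : JostData r μ C κ μ₀) (b : BoundedContinuousFunction (ℝ × ℝ) ℝ) :
    BoundedContinuousFunction (ℝ × ℝ) ℝ :=
  have hw : Continuous fun p : ℝ × ℝ => jostWeight C κ μ₀ p.2 :=
    (continuous_jostWeight C κ μ₀).comp continuous_snd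
  BoundedContinuousFunction.ofNormedAddCommGroup
    (fun p => (jostWeight C κ μ₀ p.2)⁻¹ *
      (1 + jostIntegral r (μ p.1) (fun s => jostWeight C κ μ₀ s * b (p.1, s)) p.2))
    ((hw.inv₀ fun p => (jostWeight_pos C κ μ₀ p.2).ne').mul (continuous_const.add
      (h.continuous_jostIntegral (hw.mul b.continuous) (abs_jostWeight_mul_le b))))
    (1 + ‖b‖ / 2) (fun p => h.abs_one_add_jostIntegral_le b p.1 p.2)

theorem operator_apply (h : JostData r μ C κ μ₀) (b : BoundedContinuousFunction (ℝ × ℝ) ℝ)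
    (l x : ℝ) : h.operator b (l, x) = (jostWeight C κ μ₀ x)⁻¹ *
      (1 + jostIntegral r (μ l) (fun s => jostWeight C κ μ₀ s * b (l, s)) x) := rfl

theorem norm_operator_le (h : JostData r μ C κ μ₀) (b : BoundedContinuousFunction (ℝ × ℝ) ℝ) :
    ‖h.operator b‖ ≤ 1 + ‖b‖ / 2 :=
  (BoundedContinuousFunction.norm_le (by positivity)).2 fun p =>
    h.abs_one_add_jostIntegral_le b p.1 p.2

theorem jostIntegral_sub (h : JostData r μ C κ μ₀) (a b : BoundedContinuousFunction (ℝ × ℝ) ℝ)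
    (l x : ℝ) :
    jostIntegral r (μ l) (fun s => jostWeight C κ μ₀ s * (a - b) (l, s)) x =
      jostIntegral r (μ l) (fun s => jostWeight C κ μ₀ s * a (l, s)) x -
        jostIntegral r (μ l) (fun s => jostWeight C κ μ₀ s * b (l, s)) x := by
  have hi : ∀ c : BoundedContinuousFunction (ℝ × ℝ) ℝ, Integrable fun s =>
      jostKernel (μ l) (s - x) * (r s * (jostWeight C κ μ₀ s * c (l, s))) := fun c =>
    h.integrable_integrand ((continuous_jostWeight C κ μ₀).mul (c.continuous.comp (by fun_prop)))
      (abs_jostWeight_mul_le c l) l x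
  unfold jostIntegral
  rw [← integral_sub (hi a) (hi b)]
  congr 1; ext s
  simp only [BoundedContinuousFunction.coe_sub, Pi.sub_apply]
  ring

theorem contractingWith_operator (h : JostData r μ C κ μ₀) :
    ContractingWith (1 / 2) h.operator := by
  refine ⟨by norm_num, LipschitzWith.of_dist_le_mul fun a b => ?_⟩
  rw [BoundedContinuousFunction.dist_le (by positivity)]
  rintro ⟨l, x⟩
  have hw := jostWeight_pos C κ μ₀ x
  rw [Real.dist_eq, operator_apply, operator_apply, ← mul_sub, add_sub_add_left_eq_sub,
    ← h.jostIntegral_sub, abs_mul, abs_inv, abs_of_pos hw, inv_mul_le_iff₀ hw, dist_eq_norm]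
  refine (h.abs_jostIntegral_le (abs_jostWeight_mul_le (a - b) l) l x).trans ?_
  push_cast
  nlinarith [norm_nonneg (a - b)]

/-- The Jost solutions divided by their leading exponentials `e^{-μ l x}`. -/
def amplitude (h : JostData r μ C κ μ₀) (l x : ℝ) : ℝ :=
  jostWeight C κ μ₀ x * h.contractingWith_operator.fixedPoint _ (l, x)

theorem continuous_amplitude (h : JostData r μ C κ μ₀) :
    Continuous fun p : ℝ × ℝ => h.amplitude p.1 p.2 :=
  ((continuous_jostWeight C κ μ₀).comp continuous_snd).mul (map_continuous _)

theorem amplitude_eq (h : JostData r μ C κ μ₀) (l x : ℝ) :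
    h.amplitude l x = 1 + jostIntegral r (μ l) (h.amplitude l) x := by
  have hfix := h.contractingWith_operator.fixedPoint_isFixedPt
  calc h.amplitude l x
      = jostWeight C κ μ₀ x * h.operator (h.contractingWith_operator.fixedPoint _) (l, x) := by
        rw [hfix, amplitude]
    _ = 1 + jostIntegral r (μ l) (h.amplitude l) x := by
        rw [operator_apply, mul_inv_cancel_left₀ (jostWeight_pos C κ μ₀ x).ne']
        rfl

theorem abs_amplitude_le (h : JostData r μ C κ μ₀) (l x : ℝ) :
    |h.amplitude l x| ≤ 2 * jostWeight C κ μ₀ x := by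
  have hfix := h.contractingWith_operator.fixedPoint_isFixedPt
  have hnorm := h.norm_operator_le (h.contractingWith_operator.fixedPoint _)
  rw [hfix] at hnorm
  refine (abs_jostWeight_mul_le _ l x).trans ?_
  exact mul_le_mul_of_nonneg_right (by linarith) (jostWeight_pos C κ μ₀ x).le

theorem tendsto_amplitude (h : JostData r μ C κ μ₀) (l : ℝ) :
    Tendsto (h.amplitude l) atTop (𝓝 1) := by
  rw [tendsto_iff_norm_sub_tendsto_zero]
  have hw : Tendsto (fun x => jostWeight C κ μ₀ x - 1) atTop (𝓝 0) := by
    simpa using h.tendsto_weight.sub_const 1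
  refine squeeze_zero (fun x => norm_nonneg _) (fun x => ?_) hw
  rw [h.amplitude_eq, add_sub_cancel_left, Real.norm_eq_abs]
  exact (h.abs_jostIntegral_le (h.abs_amplitude_le l) l x).trans_eq (by ring)

theorem integrableOn_mul (h : JostData r μ C κ μ₀) {v : ℝ → ℝ} (hv : Continuous v) {M : ℝ}
    (hM : ∀ s, |v s| ≤ M * jostWeight C κ μ₀ s) (x : ℝ) :
    IntegrableOn (fun s => r s * v s) (Ioi x) :=
  ((h.integrableOn_density x).const_mul M).mono'
    (h.measurable.mul hv.measurable).aestronglyMeasurable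
    (Eventually.of_forall fun s => h.abs_mul_le (hM s))

theorem abs_exp_mul_le (h : JostData r μ C κ μ₀) {y M s x : ℝ} (l : ℝ) (hxs : x ≤ s)
    (hy : |y| ≤ M * jostWeight C κ μ₀ s) :
    |Real.exp (-(2 * μ l) * (s - x)) * (r s * y)| ≤ M * jostDensity C κ μ₀ s := by
  rw [abs_mul, Real.abs_exp]
  refine (mul_le_of_le_one_left (abs_nonneg _) (Real.exp_le_one_iff.2 ?_)).trans (h.abs_mul_le hy)
  nlinarith [h.μ_pos l]

theorem integrableOn_exp_sub_mul (h : JostData r μ C κ μ₀) {v : ℝ → ℝ} (hv : Continuous v) {M : ℝ}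
    (hM : ∀ s, |v s| ≤ M * jostWeight C κ μ₀ s) (l x : ℝ) :
    IntegrableOn (fun s => Real.exp (-(2 * μ l) * (s - x)) * (r s * v s)) (Ioi x) :=
  ((h.integrableOn_density x).const_mul M).mono'
    ((Continuous.measurable (by fun_prop)).mul
      (h.measurable.mul hv.measurable)).aestronglyMeasurable
    (ae_restrict_of_forall_mem measurableSet_Ioi fun s hs => h.abs_exp_mul_le l hs.out.le (hM s))

theorem integrableOn_exp_mul (h : JostData r μ C κ μ₀) {v : ℝ → ℝ} (hv : Continuous v) {M : ℝ}
    (hM : ∀ s, |v s| ≤ M * jostWeight C κ μ₀ s) (l x : ℝ) :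
    IntegrableOn (fun s => Real.exp (-(2 * μ l) * s) * (r s * v s)) (Ioi x) := by
  refine IntegrableOn.congr_fun ((h.integrableOn_exp_sub_mul hv hM l x).const_mul
    (Real.exp (-(2 * μ l) * x))) (fun s _ => ?_) measurableSet_Ioi
  rw [← mul_assoc, ← Real.exp_add]
  ring_nf

theorem jostIntegral_eq (h : JostData r μ C κ μ₀) {v : ℝ → ℝ} (hv : Continuous v) {M : ℝ}
    (hM : ∀ s, |v s| ≤ M * jostWeight C κ μ₀ s) (l x : ℝ) :
    jostIntegral r (μ l) v x = ((∫ s in Ioi x, r s * v s) -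
      ∫ s in Ioi x, Real.exp (-(2 * μ l) * (s - x)) * (r s * v s)) / (2 * μ l) := by
  rw [← integral_sub (h.integrableOn_mul hv hM x) (h.integrableOn_exp_sub_mul hv hM l x),
    ← integral_div, ← integral_indicator measurableSet_Ioi, jostIntegral]
  congr 1; ext s
  by_cases hs : s ∈ Ioi x
  · rw [indicator_of_mem hs, jostKernel_of_nonneg (sub_nonneg.2 hs.out.le)]
    ring
  · rw [indicator_of_notMem hs, jostKernel_of_nonpos (by simpa using hs), zero_mul]

/-- The derivative in `x` of the Jost amplitude. -/
def amplitudeDeriv (h : JostData r μ C κ μ₀) (l x : ℝ) : ℝ :=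
  -∫ s in Ioi x, Real.exp (-(2 * μ l) * (s - x)) * (r s * h.amplitude l s)

theorem continuous_amplitude_right (h : JostData r μ C κ μ₀) (l : ℝ) :
    Continuous (h.amplitude l) :=
  h.continuous_amplitude.comp (Continuous.prodMk_right l)

theorem measurable_mul_amplitude (h : JostData r μ C κ μ₀) (l : ℝ) :
    Measurable fun s => r s * h.amplitude l s :=
  h.measurable.mul (h.continuous_amplitude_right l).measurable

theorem continuous_amplitudeDeriv_right (h : JostData r μ C κ μ₀) (l : ℝ) :
    Continuous (h.amplitudeDeriv l) :=
  (continuous_integral_Ioi_exp_mul_sub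
    (h.integrableOn_exp_mul (h.continuous_amplitude_right l) (h.abs_amplitude_le l) l)).neg

theorem continuous_amplitudeDeriv_left (h : JostData r μ C κ μ₀) (x : ℝ) :
    Continuous fun l => h.amplitudeDeriv l x := by
  have hμ := h.continuous_μ
  refine (continuous_of_dominated (bound := fun s => 2 * jostDensity C κ μ₀ s) (fun l => ?_)
    (fun l => ?_) ((h.integrableOn_density x).const_mul 2) ?_).neg
  · exact ((Continuous.measurable (by fun_prop)).mul
      (h.measurable_mul_amplitude l)).aestronglyMeasurable
  · exact ae_restrict_of_forall_mem measurableSet_Ioi fun s hs =>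
      h.abs_exp_mul_le l hs.out.le (h.abs_amplitude_le l s)
  · have hv := h.continuous_amplitude
    exact Eventually.of_forall fun s => (by fun_prop : Continuous fun l =>
      Real.exp (-(2 * μ l) * (s - x))).mul (continuous_const.mul
        (hv.comp (Continuous.prodMk_left s)))

theorem abs_amplitudeDeriv_le (h : JostData r μ C κ μ₀) (l x : ℝ) :
    |h.amplitudeDeriv l x| ≤ 2 * (μ₀ * (jostWeight C κ μ₀ x - 1)) := by
  rw [← h.integral_density, ← integral_const_mul, amplitudeDeriv, abs_neg, ← Real.norm_eq_abs]
  exact norm_integral_le_of_norm_le ((h.integrableOn_density x).const_mul 2)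
    (ae_restrict_of_forall_mem measurableSet_Ioi fun s hs =>
      h.abs_exp_mul_le l hs.out.le (h.abs_amplitude_le l s))

theorem hasDerivAt_amplitudeDeriv (h : JostData r μ C κ μ₀) (l : ℝ) {x : ℝ}
    (hx : ContinuousAt r x) :
    HasDerivAt (h.amplitudeDeriv l)
      (2 * μ l * h.amplitudeDeriv l x + r x * h.amplitude l x) x := by
  refine (hasDerivAt_integral_Ioi_exp_mul_sub (h.measurable_mul_amplitude l)
    (h.integrableOn_exp_mul (h.continuous_amplitude_right l) (h.abs_amplitude_le l) l)
    (hx.mul (h.continuous_amplitude_right l).continuousAt)).neg.congr_deriv ?_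
  rw [amplitudeDeriv]
  ring

theorem hasDerivAt_amplitude_of_continuousAt (h : JostData r μ C κ μ₀) (l : ℝ) {x : ℝ}
    (hx : ContinuousAt r x) :
    HasDerivAt (h.amplitude l) (h.amplitudeDeriv l x) x := by
  have hv := h.continuous_amplitude_right l
  have hb := h.abs_amplitude_le l
  have hμ := (h.μ_pos l).ne'
  have hrv : ContinuousAt (fun s => r s * h.amplitude l s) x := hx.mul hv.continuousAt
  have hvolterra : h.amplitude l = fun x => 1 + ((∫ s in Ioi x, r s * h.amplitude l s) -
      ∫ s in Ioi x, Real.exp (-(2 * μ l) * (s - x)) * (r s * h.amplitude l s)) / (2 * μ l) :=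
    funext fun x => by rw [← h.jostIntegral_eq hv hb, ← h.amplitude_eq]
  have htail := hasDerivAt_integral_Ioi (h.measurable_mul_amplitude l) (h.integrableOn_mul hv hb)
    hrv
  have hexp_tail := hasDerivAt_integral_Ioi_exp_mul_sub (h.measurable_mul_amplitude l)
    (h.integrableOn_exp_mul hv hb l) hrv
  rw [hvolterra]
  refine (((htail.sub hexp_tail).div_const (2 * μ l)).const_add 1).congr_deriv ?_
  rw [amplitudeDeriv]
  field_simp
  ring

theorem hasDerivAt_amplitude (h : JostData r μ C κ μ₀) {S : Set ℝ} (hS : S.Countable)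
    (hr : ∀ x ∉ S, ContinuousAt r x) (l x : ℝ) :
    HasDerivAt (h.amplitude l) (h.amplitudeDeriv l x) x :=
  hasDerivAt_of_hasDerivAt_off_countable hS (h.continuous_amplitude_right l)
    (h.continuous_amplitudeDeriv_right l)
    (fun y hy => h.hasDerivAt_amplitude_of_continuousAt l (hr y hy)) x

end JostData

/-- The Jost solutions at `+∞`: a family `f l`, `l ≥ 0`, of solutions of `y'' = (l - q) y` that
decay exponentially at `+∞`, are positive near `+∞`, and whose Cauchy data at `0` depend
continuously on `l`. Here `f' l` is the derivative of `f l`, and the equation holds off the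
exceptional set `S`. The Jost solutions at `-∞` are encoded as the family of the reflected
potential `fun x => q (-x)`. -/
structure IsJostFamily (q : ℝ → ℝ) (S : Set ℝ) (f f' : ℝ → ℝ → ℝ) : Prop where
  hasDerivAt : ∀ l, 0 ≤ l → ∀ x, HasDerivAt (f l) (f' l x) x
  continuous_deriv : ∀ l, 0 ≤ l → Continuous (f' l)
  ode : ∀ l, 0 ≤ l → ∀ x ∉ S, HasDerivAt (f' l) ((l - q x) * f l x) x
  continuousOn_zero : ContinuousOn (fun l => f l 0) (Ici 0)
  continuousOn_deriv_zero : ContinuousOn (fun l => f' l 0) (Ici 0)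
  decay : ∀ l, 0 ≤ l → ∃ C ν : ℝ, 0 < ν ∧
    ∀ x, 0 ≤ x → |f l x| ≤ C * Real.exp (-ν * x) ∧ |f' l x| ≤ C * Real.exp (-ν * x)
  eventually_pos : ∀ l, 0 ≤ l → ∀ᶠ x in atTop, 0 < f l x

namespace JostData

variable {r μ : ℝ → ℝ} {C κ μ₀ : ℝ}

theorem exists_decay (h : JostData r μ C κ μ₀) (l : ℝ) :
    ∃ A ν : ℝ, 0 < ν ∧ ∀ x, 0 ≤ x →
      |Real.exp (-μ l * x) * h.amplitude l x| ≤ A * Real.exp (-ν * x) ∧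
      |Real.exp (-μ l * x) * (h.amplitudeDeriv l x - μ l * h.amplitude l x)| ≤
        A * Real.exp (-ν * x) := by
  set w₀ := jostWeight C κ μ₀ 0
  have hμ := h.μ_pos l
  have hμ₀ := h.μ₀_pos
  have hw₀ : 1 ≤ w₀ := h.one_le_weight 0
  have hpos : 0 ≤ 2 * (μ₀ * (w₀ - 1)) := by nlinarith
  refine ⟨2 * (μ₀ * (w₀ - 1)) + (1 + μ l) * (2 * w₀), μ l, hμ, fun x hx => ?_⟩
  have hw : jostWeight C κ μ₀ x ≤ w₀ := h.weight_antitone hx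
  have hv : |h.amplitude l x| ≤ 2 * w₀ := (h.abs_amplitude_le l x).trans (by linarith)
  have hv' : |h.amplitudeDeriv l x| ≤ 2 * (μ₀ * (w₀ - 1)) :=
    (h.abs_amplitudeDeriv_le l x).trans (by gcongr)
  have hμv : |μ l * h.amplitude l x| ≤ μ l * (2 * w₀) := by
    rw [abs_mul, abs_of_pos hμ]
    gcongr
  have hsub := abs_sub (h.amplitudeDeriv l x) (μ l * h.amplitude l x)
  rw [abs_mul, abs_mul, Real.abs_exp, mul_comm, mul_comm (Real.exp _)]
  constructor <;> refine mul_le_mul_of_nonneg_right ?_ (Real.exp_pos _).le <;> nlinarith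

theorem isJostFamily (h : JostData r μ C κ μ₀) {q : ℝ → ℝ} {S : Set ℝ} (hS : S.Countable)
    (hr : ∀ x ∉ S, ContinuousAt r x) (hq : ∀ l, 0 ≤ l → ∀ x, μ l ^ 2 + r x = l - q x) :
    IsJostFamily q S (fun l x => Real.exp (-μ l * x) * h.amplitude l x)
      (fun l x => Real.exp (-μ l * x) * (h.amplitudeDeriv l x - μ l * h.amplitude l x)) where
  hasDerivAt l _ x := ((hasDerivAt_exp_mul (-μ l) x).mul
    (h.hasDerivAt_amplitude hS hr l x)).congr_deriv (by ring)
  continuous_deriv l _ := by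
    have := h.continuous_amplitude_right l
    have := h.continuous_amplitudeDeriv_right l
    fun_prop
  ode l hl x hx := by
    refine ((hasDerivAt_exp_mul (-μ l) x).mul ((h.hasDerivAt_amplitudeDeriv l (hr x hx)).sub
      ((h.hasDerivAt_amplitude hS hr l x).const_mul (μ l)))).congr_deriv ?_
    rw [← hq l hl x, Pi.sub_apply]
    ring
  continuousOn_zero := by
    have := h.continuous_μ
    have := h.continuous_amplitude.comp (Continuous.prodMk_left (X := ℝ) (0 : ℝ))
    exact Continuous.continuousOn ((by fun_prop : Continuous fun l => Real.exp (-μ l * 0)).mul this)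
  continuousOn_deriv_zero := by
    have hμ := h.continuous_μ
    have hv := h.continuous_amplitude.comp (Continuous.prodMk_left (X := ℝ) (0 : ℝ))
    exact Continuous.continuousOn ((by fun_prop : Continuous fun l => Real.exp (-μ l * 0)).mul
      ((h.continuous_amplitudeDeriv_left 0).sub (hμ.mul hv)))
  decay l _ := h.exists_decay l
  eventually_pos l _ := by
    filter_upwards [(h.tendsto_amplitude l).eventually (lt_mem_nhds zero_lt_one)] with x hx
      using mul_pos (Real.exp_pos _) hx

end JostData

theorem exists_isJostFamily {q : ℝ → ℝ} {S : Set ℝ} (hS : S.Countable) (hq : Measurable q)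
    (hqc : ∀ x ∉ S, ContinuousAt q x) {qe C κ : ℝ} (hqe : qe < 0) (hκ : 0 < κ)
    (hb : ∀ x, |q x - qe| ≤ C * Real.exp (-κ * x)) :
    ∃ f f' : ℝ → ℝ → ℝ, IsJostFamily q S f f' := by
  have hdata : JostData (fun s => qe - q s) (fun l => √(max l 0 - qe)) (|C| + 1) κ √(-qe) :=
    { measurable := by fun_prop
      bound := fun s => by
        rw [abs_sub_comm]
        refine (hb s).trans (mul_le_mul_of_nonneg_right ?_ (Real.exp_pos _).le)
        linarith [le_abs_self C]
      C_pos := by positivity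
      κ_pos := hκ
      μ₀_pos := Real.sqrt_pos.2 (by linarith)
      continuous_μ := by fun_prop
      le_μ := fun l => Real.sqrt_le_sqrt (by linarith [le_max_right l 0]) }
  refine ⟨_, _, hdata.isJostFamily hS (fun x hx => continuousAt_const.sub (hqc x hx))
    fun l hl x => ?_⟩
  rw [max_eq_left hl, Real.sq_sqrt (by linarith)]
  ring

theorem intervalIntegrable_of_bounded {q : ℝ → ℝ} (hq : Measurable q) {K : ℝ}
    (hK : ∀ x, |q x| ≤ K) (a b : ℝ) : IntervalIntegrable q volume a b :=
  (intervalIntegrable_const (c := K)).mono_fun hq.aestronglyMeasurable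
    (Eventually.of_forall fun x => (hK x).trans (le_abs_self K))

theorem isWeakDeriv_of_hasDerivAt_off_countable {F F' : ℝ → ℝ} {S : Set ℝ} (hS : S.Countable)
    (hF : Continuous F) (hd : ∀ x ∉ S, HasDerivAt F (F' x) x)
    (hi : ∀ a b, IntervalIntegrable F' volume a b) : IsWeakDeriv F F' := by
  intro φ hφ hc
  obtain ⟨R, hR⟩ := hc.isCompact.isBounded.subset_ball (0 : ℝ)
  have hball : ∀ x ∈ tsupport φ, x ∈ Ioo (-R) R := fun x hx => by
    simpa [abs_lt] using hR hx
  have hφ_supp : ∀ x, φ x ≠ 0 → x ∈ Ioo (-R) R := fun x hx => hball x (subset_tsupport φ hx)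
  have hφ'_supp : ∀ x, deriv φ x ≠ 0 → x ∈ Ioo (-R) R :=
    fun x hx => hball x (support_deriv_subset hx)
  have hφd : ∀ x, HasDerivAt φ (deriv φ x) x := fun x =>
    (hφ.differentiable (by simp)).differentiableAt.hasDerivAt
  have hφR : φ R = 0 := by_contra fun h => lt_irrefl _ (hφ_supp R h).2
  have hφR' : φ (-R) = 0 := by_contra fun h => lt_irrefl _ (hφ_supp (-R) h).1
  have hi₁ : IntervalIntegrable (fun x => F' x * φ x) volume (-R) R :=
    (hi _ _).mul_continuousOn hφ.continuous.continuousOn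
  have hi₂ : IntervalIntegrable (fun x => F x * deriv φ x) volume (-R) R :=
    (hF.mul (hφ.continuous_deriv (by simp))).intervalIntegrable _ _
  have hparts := integral_eq_of_hasDerivAt_off_countable (fun x => F x * φ x)
    (fun x => F' x * φ x + F x * deriv φ x) hS (a := -R) (b := R)
    (hF.mul hφ.continuous).continuousOn (fun x hx => (hd x hx.2).mul (hφd x)) (hi₁.add hi₂)
  rw [intervalIntegral.integral_add hi₁ hi₂, hφR, hφR',
    intervalIntegral.integral_eq_integral_of_support_subset
      fun x hx => Ioo_subset_Ioc_self (hφ_supp x (right_ne_zero_of_mul hx)),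
    intervalIntegral.integral_eq_integral_of_support_subset
      fun x hx => Ioo_subset_Ioc_self (hφ'_supp x (right_ne_zero_of_mul hx))] at hparts
  linarith

theorem integrableOn_sq_of_le_exp {φ : ℝ → ℝ} (hφ : Continuous φ) {C ν : ℝ} (hν : 0 < ν)
    (hb : ∀ᶠ x in atTop, |φ x| ≤ C * Real.exp (-ν * x)) :
    IntegrableOn (fun x => φ x ^ 2) (Ioi 0) := by
  refine integrable_of_isBigO_exp_neg (a := 0) (b := 2 * ν) (by positivity)
    (hφ.pow 2).continuousOn (Asymptotics.IsBigO.of_bound (C ^ 2) ?_)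
  filter_upwards [hb] with x hx
  have hexp : Real.exp (-(2 * ν) * x) = Real.exp (-ν * x) ^ 2 := by
    rw [← Real.exp_nat_mul]
    push_cast
    ring_nf
  rw [norm_pow, Real.norm_eq_abs, Real.norm_eq_abs, Real.abs_exp, hexp, ← mul_pow]
  gcongr

theorem memLp_two_of_le_exp {φ : ℝ → ℝ} (hφ : Continuous φ) {C ν C' ν' : ℝ} (hν : 0 < ν)
    (hν' : 0 < ν') (hb : ∀ᶠ x in atTop, |φ x| ≤ C * Real.exp (-ν * x))
    (hb' : ∀ᶠ x in atTop, |φ (-x)| ≤ C' * Real.exp (-ν' * x)) : MemLp φ 2 := by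
  rw [memLp_two_iff_integrable_sq hφ.aestronglyMeasurable, ← integrableOn_univ,
    ← Iic_union_Ioi (a := (0 : ℝ)), integrableOn_union, integrableOn_Iic_iff_integrableOn_Iio]
  refine ⟨?_, integrableOn_sq_of_le_exp hφ hν hb⟩
  rw [← (Measure.measurePreserving_neg (volume : Measure ℝ)).integrableOn_comp_preimage
    (Homeomorph.neg ℝ).measurableEmbedding]
  simpa [Function.comp_def] using integrableOn_sq_of_le_exp (hφ.comp continuous_neg) hν' hb'

theorem eq_of_hasDerivAt_zero_of_tendsto {F : ℝ → ℝ} {R a x : ℝ} (hF : ContinuousOn F (Ici R))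
    (hd : ∀ y, R < y → HasDerivAt F 0 y) (ha : Tendsto F atTop (𝓝 a)) (hx : R ≤ x) : F x = a := by
  refine tendsto_nhds_unique (tendsto_const_nhds.congr' ?_) ha
  filter_upwards [eventually_ge_atTop x] with y hxy
  refine eq_of_hasDerivAt_zero_off_countable countable_empty
    (hF.mono fun z hz => hx.trans (uIcc_of_le hxy ▸ hz).1) fun z hz => hd z ?_
  rw [min_eq_left hxy] at hz
  exact hx.trans_lt hz.1.1

/-! ### The Evans function -/

/-- `Λ` is an eigenvalue of the Schrödinger operator `D_xx + q` on `L²(ℝ)` with domain `H²(ℝ)`;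
derivatives are weak derivatives, as in `IsLinearisationEigenvalue`, which is the case
`q = ∂²V/∂u² (u(x), x)`. -/
def IsSchrodingerEigenvalue (q : ℝ → ℝ) (Λ : ℝ) : Prop :=
  ∃ Ψ Ψ₁ Ψ₂ : ℝ → ℝ,
    MemLp Ψ 2 ∧ MemLp Ψ₁ 2 ∧ MemLp Ψ₂ 2 ∧ IsWeakDeriv Ψ Ψ₁ ∧ IsWeakDeriv Ψ₁ Ψ₂ ∧
    ¬ (Ψ =ᵐ[volume] 0) ∧ ∀ᵐ x, Ψ₂ x + q x * Ψ x = Λ * Ψ x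

/-- The Wronskian at `x` of the Jost solutions `g l (-x)` at `-∞` and `f l x` at `+∞`. As a
function of `l` it is the Evans function, whose zeros are eigenvalues. -/
def jostWronskian (f f' g g' : ℝ → ℝ → ℝ) (l x : ℝ) : ℝ :=
  g l (-x) * f' l x + g' l (-x) * f l x

namespace IsJostFamily

variable {q : ℝ → ℝ} {S : Set ℝ} {f f' g g' : ℝ → ℝ → ℝ} {l K : ℝ}

theorem continuous (h : IsJostFamily q S f f') (hl : 0 ≤ l) : Continuous (f l) :=
  continuous_iff_continuousAt.2 fun x => (h.hasDerivAt l hl x).continuousAt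

theorem tendsto_zero (h : IsJostFamily q S f f') (hl : 0 ≤ l) : Tendsto (f l) atTop (𝓝 0) := by
  obtain ⟨C, ν, hν, hb⟩ := h.decay l hl
  refine squeeze_zero_norm' ?_ (tendsto_mul_exp_neg_mul_atTop C hν)
  filter_upwards [eventually_ge_atTop 0] with x hx using (hb x hx).1

theorem tendsto_deriv_zero (h : IsJostFamily q S f f') (hl : 0 ≤ l) :
    Tendsto (f' l) atTop (𝓝 0) := by
  obtain ⟨C, ν, hν, hb⟩ := h.decay l hl
  refine squeeze_zero_norm' ?_ (tendsto_mul_exp_neg_mul_atTop C hν)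
  filter_upwards [eventually_ge_atTop 0] with x hx using (hb x hx).2

theorem monotone_mul_deriv (h : IsJostFamily q S f f') (hS : S.Countable) (hq : Measurable q)
    (hK : ∀ x, |q x| ≤ K) (hl : K ≤ l) : Monotone fun x => f l x * f' l x := by
  have hl₀ : 0 ≤ l := ((abs_nonneg _).trans (hK 0)).trans hl
  have hf := h.continuous hl₀
  have hf' := h.continuous_deriv l hl₀
  have hd : ∀ x ∉ S, HasDerivAt (fun x => f l x * f' l x)
      ((l - q x) * f l x ^ 2 + f' l x ^ 2) x := fun x hx =>
    ((h.hasDerivAt l hl₀ x).mul (h.ode l hl₀ x hx)).congr_deriv (by ring)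
  refine monotone_of_hasDerivAt_off_countable hS (hf.mul hf') hd (fun a b => ?_) fun x => ?_
  · exact ((intervalIntegrable_const.sub (intervalIntegrable_of_bounded hq hK a b)).mul_continuousOn
      (hf.pow 2).continuousOn).add ((hf'.pow 2).intervalIntegrable a b)
  · have := sub_nonneg.2 ((abs_le.1 (hK x)).2.trans hl)
    positivity

theorem mul_deriv_neg (h : IsJostFamily q S f f') (hS : S.Countable) (hq : Measurable q)
    (hK : ∀ x, |q x| ≤ K) (hl : K ≤ l) (x : ℝ) : f l x * f' l x < 0 := by
  have hl₀ : 0 ≤ l := ((abs_nonneg _).trans (hK 0)).trans hl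
  have hmono := h.monotone_mul_deriv hS hq hK hl
  have htend : Tendsto (fun x => f l x * f' l x) atTop (𝓝 0) := by
    simpa using (h.tendsto_zero hl₀).mul (h.tendsto_deriv_zero hl₀)
  refine lt_of_le_of_ne (hmono.ge_of_tendsto htend x) fun hx => ?_
  have hzero : ∀ y, x ≤ y → f l y * f' l y = 0 := fun y hy =>
    le_antisymm (hmono.ge_of_tendsto htend y) (hx.symm.le.trans (hmono hy))
  have hsq : ∀ y, x ≤ y → f l y ^ 2 = 0 := fun y hy =>
    eq_of_hasDerivAt_zero_of_tendsto (F := fun z => f l z ^ 2)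
      ((h.continuous hl₀).pow 2).continuousOn
      (fun z hz => ((h.hasDerivAt l hl₀ z).pow 2).congr_deriv (by
        linear_combination 2 * hzero z hz.le))
      (by simpa using (h.tendsto_zero hl₀).pow 2) hy
  obtain ⟨y, hy, hxy⟩ := ((h.eventually_pos l hl₀).and (eventually_ge_atTop x)).exists
  exact hy.ne' (sq_eq_zero_iff.1 (hsq y hxy))

theorem pos (h : IsJostFamily q S f f') (hS : S.Countable) (hq : Measurable q)
    (hK : ∀ x, |q x| ≤ K) (hl : K ≤ l) (x : ℝ) : 0 < f l x := by
  have hl₀ : 0 ≤ l := ((abs_nonneg _).trans (hK 0)).trans hl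
  by_contra! hx
  obtain ⟨y, hy, hxy⟩ := ((h.eventually_pos l hl₀).and (eventually_ge_atTop x)).exists
  obtain ⟨z, -, hz⟩ := intermediate_value_Icc hxy (h.continuous hl₀).continuousOn ⟨hx, hy.le⟩
  have := h.mul_deriv_neg hS hq hK hl z
  rw [hz, zero_mul] at this
  exact lt_irrefl _ this

theorem deriv_neg (h : IsJostFamily q S f f') (hS : S.Countable) (hq : Measurable q)
    (hK : ∀ x, |q x| ≤ K) (hl : K ≤ l) (x : ℝ) : f' l x < 0 :=
  neg_of_mul_neg_right (h.mul_deriv_neg hS hq hK hl x) (h.pos hS hq hK hl x).le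

theorem jostWronskian_eq (hf : IsJostFamily q S f f') (hg : IsJostFamily (fun x => q (-x)) S g g')
    (hS : S.Countable) (hsymm : ∀ x ∉ S, -x ∉ S) (hl : 0 ≤ l) (x y : ℝ) :
    jostWronskian f f' g g' l x = jostWronskian f f' g g' l y := by
  have hcont : Continuous (jostWronskian f f' g g' l) :=
    (((hg.continuous hl).comp continuous_neg).mul (hf.continuous_deriv l hl)).add
      (((hg.continuous_deriv l hl).comp continuous_neg).mul (hf.continuous hl))
  refine eq_of_hasDerivAt_zero_off_countable hS hcont.continuousOn fun z hz => ?_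
  have hgz := hasDerivAt_comp_neg (hg.hasDerivAt l hl (-z))
  have hgz' := hasDerivAt_comp_neg (hg.ode l hl (-z) (hsymm z hz.2))
  refine ((hgz.mul (hf.ode l hl z hz.2)).add (hgz'.mul (hf.hasDerivAt l hl z))).congr_deriv ?_
  rw [neg_neg]
  ring

theorem continuousOn_jostWronskian (hf : IsJostFamily q S f f')
    (hg : IsJostFamily (fun x => q (-x)) S g g') :
    ContinuousOn (fun l => jostWronskian f f' g g' l 0) (Ici 0) := by
  unfold jostWronskian
  rw [neg_zero]
  exact (hg.continuousOn_zero.mul hf.continuousOn_deriv_zero).add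
    (hg.continuousOn_deriv_zero.mul hf.continuousOn_zero)

theorem jostWronskian_neg (hf : IsJostFamily q S f f')
    (hg : IsJostFamily (fun x => q (-x)) S g g') (hS : S.Countable) (hq : Measurable q)
    (hK : ∀ x, |q x| ≤ K) (hl : K ≤ l) (x : ℝ) : jostWronskian f f' g g' l x < 0 :=
  have hq' := hq.comp measurable_neg
  have hK' : ∀ x, |q (-x)| ≤ K := fun x => hK (-x)
  add_neg (mul_neg_of_pos_of_neg (hg.pos hS hq' hK' hl _) (hf.deriv_neg hS hq hK hl x))
    (mul_neg_of_neg_of_pos (hg.deriv_neg hS hq' hK' hl _) (hf.pos hS hq hK hl x))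

theorem exists_pos_jostWronskian_eq_zero (hf : IsJostFamily q S f f')
    (hg : IsJostFamily (fun x => q (-x)) S g g') (hS : S.Countable) (hq : Measurable q)
    (hK : ∀ x, |q x| ≤ K) (hW : 0 < jostWronskian f f' g g' 0 0) :
    ∃ Λ, 0 < Λ ∧ jostWronskian f f' g g' Λ 0 = 0 := by
  have hK₀ : 0 ≤ K := (abs_nonneg _).trans (hK 0)
  have hWK := hf.jostWronskian_neg hg hS hq hK le_rfl 0
  obtain ⟨Λ, hΛ, hWΛ⟩ := intermediate_value_Icc' hK₀
    ((hf.continuousOn_jostWronskian hg).mono Icc_subset_Ici_self) ⟨hWK.le, hW.le⟩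
  refine ⟨Λ, lt_of_le_of_ne hΛ.1 ?_, hWΛ⟩
  rintro rfl
  exact hW.ne' hWΛ

theorem exists_eventually_eq_mul (hf : IsJostFamily q S f f')
    (hg : IsJostFamily (fun x => q (-x)) S g g') (hl : 0 ≤ l)
    (hW : ∀ x, jostWronskian f f' g g' l x = 0) :
    ∃ c, ∀ᶠ x in atTop, f l (-x) = c * g l x ∧ f' l (-x) = -(c * g' l x) := by
  have hW' : ∀ x, g l x * f' l (-x) + g' l x * f l (-x) = 0 := fun x => by
    simpa only [jostWronskian, neg_neg] using hW (-x)
  obtain ⟨R, hR⟩ := eventually_atTop.1 (hg.eventually_pos l hl)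
  have hd : ∀ x ∈ Ioi R, HasDerivAt (fun x => f l (-x) / g l x) 0 x := fun x hx => by
    refine ((hasDerivAt_comp_neg (hf.hasDerivAt l hl (-x))).div (hg.hasDerivAt l hl x)
      (hR x hx.out.le).ne').congr_deriv (div_eq_zero_iff.2 (Or.inl ?_))
    linear_combination -hW' x
  obtain ⟨c, hc⟩ := isOpen_Ioi.exists_is_const_of_deriv_eq_zero isPreconnected_Ioi
    (fun x hx => (hd x hx).differentiableAt.differentiableWithinAt) (fun x hx => (hd x hx).deriv)
  refine ⟨c, ?_⟩
  filter_upwards [eventually_gt_atTop R] with x hx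
  have hgx := (hR x hx.le).ne'
  have hfx : f l (-x) = c * g l x := (div_eq_iff hgx).1 (hc x hx)
  refine ⟨hfx, mul_left_cancel₀ hgx ?_⟩
  linear_combination hW' x - g' l x * hfx

theorem memLp_of_jostWronskian_eq_zero (hf : IsJostFamily q S f f')
    (hg : IsJostFamily (fun x => q (-x)) S g g') (hl : 0 ≤ l)
    (hW : ∀ x, jostWronskian f f' g g' l x = 0) : MemLp (f l) 2 ∧ MemLp (f' l) 2 := by
  obtain ⟨c, hc⟩ := hf.exists_eventually_eq_mul hg hl hW
  obtain ⟨C, ν, hν, hb⟩ := hf.decay l hl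
  obtain ⟨C', ν', hν', hb'⟩ := hg.decay l hl
  constructor
  · refine memLp_two_of_le_exp (C := C) (C' := |c| * C') (hf.continuous hl) hν hν' ?_ ?_
    · filter_upwards [eventually_ge_atTop 0] with x hx using (hb x hx).1
    · filter_upwards [eventually_ge_atTop 0, hc] with x hx hcx
      rw [hcx.1, abs_mul, mul_assoc]
      exact mul_le_mul_of_nonneg_left (hb' x hx).1 (abs_nonneg c)
  · refine memLp_two_of_le_exp (C := C) (C' := |c| * C') (hf.continuous_deriv l hl) hν hν' ?_ ?_
    · filter_upwards [eventually_ge_atTop 0] with x hx using (hb x hx).2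
    · filter_upwards [eventually_ge_atTop 0, hc] with x hx hcx
      rw [hcx.2, abs_neg, abs_mul, mul_assoc]
      exact mul_le_mul_of_nonneg_left (hb' x hx).2 (abs_nonneg c)

theorem isSchrodingerEigenvalue (hf : IsJostFamily q S f f')
    (hg : IsJostFamily (fun x => q (-x)) S g g') (hS : S.Countable) (hq : Measurable q)
    (hK : ∀ x, |q x| ≤ K) (hl : 0 ≤ l) (hW : ∀ x, jostWronskian f f' g g' l x = 0) :
    IsSchrodingerEigenvalue q l := by
  have hfc := hf.continuous hl
  have hfc' := hf.continuous_deriv l hl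
  obtain ⟨hΨ, hΨ₁⟩ := hf.memLp_of_jostWronskian_eq_zero hg hl hW
  have hΨ₂ : MemLp (fun x => (l - q x) * f l x) 2 := by
    refine (hΨ.const_mul (l + K)).of_le
      ((measurable_const.sub hq).mul hfc.measurable).aestronglyMeasurable
      (Eventually.of_forall fun x => ?_)
    rw [norm_mul, norm_mul]
    refine mul_le_mul_of_nonneg_right ?_ (norm_nonneg _)
    calc |l - q x| ≤ |l| + |q x| := abs_sub _ _
      _ ≤ l + K := by rw [abs_of_nonneg hl]; gcongr; exact hK x
      _ ≤ ‖l + K‖ := le_abs_self _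
  refine ⟨f l, f' l, fun x => (l - q x) * f l x, hΨ, hΨ₁, hΨ₂, ?_, ?_, fun hzero => ?_,
    Eventually.of_forall fun x => by ring⟩
  · exact isWeakDeriv_of_hasDerivAt_off_countable countable_empty hfc
      (fun x _ => hf.hasDerivAt l hl x) fun a b => hfc'.intervalIntegrable a b
  · exact isWeakDeriv_of_hasDerivAt_off_countable hS hfc' (hf.ode l hl) fun a b =>
      (intervalIntegrable_const.sub (intervalIntegrable_of_bounded hq hK a b)).mul_continuousOn
        hfc.continuousOn
  · obtain ⟨x, hx⟩ := (hf.eventually_pos l hl).exists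
    exact hx.ne' (congr_fun ((hfc.ae_eq_iff_eq volume continuous_zero).1 hzero) x)

theorem exists_pos_isSchrodingerEigenvalue (hf : IsJostFamily q S f f')
    (hg : IsJostFamily (fun x => q (-x)) S g g') (hS : S.Countable) (hsymm : ∀ x ∉ S, -x ∉ S)
    (hq : Measurable q) (hK : ∀ x, |q x| ≤ K) (hW : 0 < jostWronskian f f' g g' 0 0) :
    ∃ Λ, 0 < Λ ∧ IsSchrodingerEigenvalue q Λ := by
  obtain ⟨Λ, hΛ, hWΛ⟩ := hf.exists_pos_jostWronskian_eq_zero hg hS hq hK hW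
  exact ⟨Λ, hΛ, hf.isSchrodingerEigenvalue hg hS hq hK hΛ.le fun x =>
    (hf.jostWronskian_eq hg hS hsymm hΛ.le x 0).trans hWΛ⟩

end IsJostFamily

/-! ### Solutions decaying at infinity -/

theorem eq_zero_of_tendsto_of_tendsto_deriv {P P' : ℝ → ℝ} {R a b : ℝ}
    (hd : ∀ x, R < x → HasDerivAt P (P' x) x) (hP : Tendsto P atTop (𝓝 a))
    (hP' : Tendsto P' atTop (𝓝 b)) : b = 0 := by
  have hmvt : ∀ x, R < x → ∃ y, x ≤ y ∧ P' y = P (x + 1) - P x := fun x hx => by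
    obtain ⟨y, hy, hslope⟩ := exists_hasDerivAt_eq_slope P P' (lt_add_one x)
      (fun z hz => (hd z (hx.trans_le hz.1)).continuousAt.continuousWithinAt)
      (fun z hz => hd z (hx.trans hz.1))
    exact ⟨y, hy.1.le, by simpa using hslope⟩
  choose! ξ hξ hξ' using hmvt
  have hξ_top : Tendsto ξ atTop atTop :=
    tendsto_atTop_mono' _ ((eventually_gt_atTop R).mono hξ) tendsto_id
  have hdiff : Tendsto (fun x => P (x + 1) - P x) atTop (𝓝 0) := by
    simpa using (hP.comp (tendsto_atTop_add_const_right _ 1 tendsto_id)).sub hP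
  exact tendsto_nhds_unique (hP'.comp hξ_top)
    (hdiff.congr' ((eventually_gt_atTop R).mono fun x hx => (hξ' x hx).symm))

theorem exists_isMaxOn_Ici_of_tendsto_zero {P : ℝ → ℝ} {R : ℝ} (hc : ContinuousOn P (Ici R))
    (hpos : 0 < P R) (hP : Tendsto P atTop (𝓝 0)) : ∃ x ∈ Ici R, IsMaxOn P (Ici R) x := by
  obtain ⟨B, hB⟩ := eventually_atTop.1 (hP.eventually (gt_mem_nhds hpos))
  obtain ⟨x, hx, hmax⟩ := isCompact_Icc.exists_isMaxOn (nonempty_Icc.2 (le_max_left R B))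
    (hc.mono Icc_subset_Ici_self)
  refine ⟨x, hx.1, fun y hy => ?_⟩
  rcases le_total y (max R B) with h | h
  · exact hmax ⟨hy, h⟩
  · exact (hB y ((le_max_right _ _).trans h)).le.trans (hmax (left_mem_Icc.2 (le_max_left R B)))

theorem nonpos_of_deriv_deriv_nonpos_of_tendsto_zero {φ φ' φ'' : ℝ → ℝ} {a : ℝ}
    (hd : ∀ x, a ≤ x → HasDerivAt φ (φ' x) x) (hd' : ∀ x, a ≤ x → HasDerivAt φ' (φ'' x) x)
    (hle : ∀ x, a ≤ x → φ'' x ≤ 0) (hφ : Tendsto φ atTop (𝓝 0)) (hφ' : Tendsto φ' atTop (𝓝 0)) :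
    φ a ≤ 0 := by
  have hanti : AntitoneOn φ' (Ici a) :=
    antitoneOn_of_hasDerivWithinAt_nonpos (convex_Ici a)
      (fun x hx => (hd' x hx).continuousAt.continuousWithinAt)
      (fun x hx => (hd' x (interior_subset hx)).hasDerivWithinAt)
      fun x hx => hle x (interior_subset hx)
  have hnonneg : ∀ x, a ≤ x → 0 ≤ φ' x := fun x hx =>
    le_of_tendsto hφ' ((eventually_ge_atTop x).mono fun y hy => hanti hx (hx.trans hy) hy)
  have hmono : MonotoneOn φ (Ici a) :=
    monotoneOn_of_hasDerivWithinAt_nonneg (convex_Ici a)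
      (fun x hx => (hd x hx).continuousAt.continuousWithinAt)
      (fun x hx => (hd x (interior_subset hx)).hasDerivWithinAt)
      fun x hx => hnonneg x (interior_subset hx)
  exact ge_of_tendsto hφ ((eventually_ge_atTop a).mono fun y hy => hmono self_mem_Ici hy hy)

/- If `qe ≥ 0`, subtracting a small exponential from `P` beyond its maximum gives a function that
is concave and vanishes at infinity, hence nonpositive; but it is positive at the maximum. -/
theorem limit_neg_of_pos_decaying_solution {q P P' : ℝ → ℝ} {R qe C κ : ℝ} (hκ : 0 < κ)
    (hb : ∀ x, |q x - qe| ≤ C * Real.exp (-κ * x)) (hP : ∀ x, R < x → HasDerivAt P (P' x) x)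
    (hP' : ∀ x, R < x → HasDerivAt P' (-(q x * P x)) x) (hP0 : Tendsto P atTop (𝓝 0))
    (hP0' : Tendsto P' atTop (𝓝 0)) (hpos : ∀ᶠ x in atTop, 0 < P x) : qe < 0 := by
  by_contra! hqe
  obtain ⟨R₁, hR₁⟩ := eventually_atTop.1 (((tendsto_mul_exp_neg_mul_atTop (C / κ ^ 2) hκ).eventually
    (gt_mem_nhds zero_lt_one)).and (hpos.and (eventually_gt_atTop R)))
  have hR : ∀ x, R₁ ≤ x → R < x := fun x hx => (hR₁ x hx).2.2
  obtain ⟨x₁, hx₁, hmax⟩ := exists_isMaxOn_Ici_of_tendsto_zero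
    (fun x hx => (hP x (hR x hx)).continuousAt.continuousWithinAt) (hR₁ R₁ le_rfl).2.1 hP0
  have hge : ∀ x, x₁ ≤ x → R₁ ≤ x := fun x hx => le_trans hx₁ hx
  set m := P x₁
  have hconcave : ∀ x, x₁ ≤ x → -(q x * P x) - C * m * Real.exp (-κ * x) ≤ 0 := fun x hx => by
    have hPx : 0 < P x := (hR₁ x (hge x hx)).2.1
    have hq : -(q x) ≤ C * Real.exp (-κ * x) := by linarith [(abs_le.1 (hb x)).1]
    have hqP : -(q x) * P x ≤ C * Real.exp (-κ * x) * m :=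
      (mul_le_mul_of_nonneg_right hq hPx.le).trans
        (mul_le_mul_of_nonneg_left (hmax (hge x hx)) ((abs_nonneg _).trans (hb x)))
    linarith
  have hle := nonpos_of_deriv_deriv_nonpos_of_tendsto_zero
    (φ := fun x => P x - C / κ ^ 2 * m * Real.exp (-κ * x))
    (φ' := fun x => P' x + C / κ * m * Real.exp (-κ * x))
    (fun x hx => ((hP x (hR x (hge x hx))).sub ((hasDerivAt_exp_mul (-κ) x).const_mul
      (C / κ ^ 2 * m))).congr_deriv (by field_simp; ring))
    (fun x hx => ((hP' x (hR x (hge x hx))).add ((hasDerivAt_exp_mul (-κ) x).const_mul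
      (C / κ * m))).congr_deriv (by field_simp; ring))
    hconcave (by simpa using hP0.sub (tendsto_mul_exp_neg_mul_atTop (C / κ ^ 2 * m) hκ))
    (by simpa using hP0'.add (tendsto_mul_exp_neg_mul_atTop (C / κ * m) hκ))
  have hsmall := (hR₁ x₁ hx₁).1
  have hm : 0 < m := (hR₁ x₁ hx₁).2.1
  nlinarith

theorem eq_zero_of_hasDerivAt_of_eq_zero_right {q w w' : ℝ → ℝ} {a b K : ℝ} (hab : a ≤ b)
    (hK : ∀ x, |q x| ≤ K) (hwc : Continuous w) (hwc' : Continuous w')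
    (hw : ∀ x, a < x → HasDerivAt w (w' x) x) (hw' : ∀ x, a < x → HasDerivAt w' (-(q x * w x)) x)
    (hb : w b = 0) (hb' : w' b = 0) : w a = 0 ∧ w' a = 0 := by
  have hlip : ∀ t ∈ Ioc a b, LipschitzOnWith (max 1 K.toNNReal)
      (fun p : ℝ × ℝ => (p.2, -(q t * p.1))) univ := fun t _ => by
    refine (LipschitzWith.prod_snd.prodMk
      (LipschitzWith.of_dist_le_mul fun x y => ?_)).lipschitzOnWith
    rw [dist_neg_neg, Real.dist_eq, ← mul_sub, abs_mul]
    exact mul_le_mul ((hK t).trans (Real.le_coe_toNNReal K)) (le_max_left _ _) (abs_nonneg _)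
      K.toNNReal.2
  have hzero := ODE_solution_unique_of_mem_Icc_left hlip (hwc.prodMk hwc').continuousOn
    (fun t ht => ((hw t ht.1).prodMk (hw' t ht.1)).hasDerivWithinAt) (fun _ _ => mem_univ _)
    (g := fun _ => (0, 0)) continuousOn_const
    (fun t _ => by simpa using! hasDerivWithinAt_const t (Iic t) ((0, 0) : ℝ × ℝ))
    (fun _ _ => mem_univ _) (by rw [hb, hb']) (left_mem_Icc.2 hab)
  exact Prod.mk.inj hzero

theorem IsJostFamily.exists_pos_eq_mul {q : ℝ → ℝ} {S : Set ℝ} {f f' : ℝ → ℝ → ℝ}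
    (h : IsJostFamily q S f f') {K R : ℝ} (hK : ∀ x, |q x| ≤ K) (hS : ∀ x, R < x → x ∉ S)
    {P P' : ℝ → ℝ} (hPc : Continuous P) (hPc' : Continuous P')
    (hP : ∀ x, R < x → HasDerivAt P (P' x) x) (hP' : ∀ x, R < x → HasDerivAt P' (-(q x * P x)) x)
    (hP0 : Tendsto P atTop (𝓝 0)) (hP0' : Tendsto P' atTop (𝓝 0))
    (hpos : ∀ᶠ x in atTop, 0 < P x) :
    ∃ c, 0 < c ∧ P R = c * f 0 R ∧ P' R = c * f' 0 R := by
  have hf := h.hasDerivAt 0 le_rfl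
  have hf' : ∀ x, R < x → HasDerivAt (f' 0) (-(q x * f 0 x)) x := fun x hx =>
    (h.ode 0 le_rfl x (hS x hx)).congr_deriv (by ring)
  have hfc := h.continuous le_rfl
  have hfc' := h.continuous_deriv 0 le_rfl
  have hwronskian : ∀ x, R ≤ x → P x * f' 0 x - P' x * f 0 x = 0 := fun x hx =>
    eq_of_hasDerivAt_zero_of_tendsto (F := fun x => P x * f' 0 x - P' x * f 0 x)
      (Continuous.continuousOn (by fun_prop))
      (fun y hy => (((hP y hy).mul (hf' y hy)).sub ((hP' y hy).mul (hf y))).congr_deriv (by ring))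
      (by simpa using
        (hP0.mul (h.tendsto_deriv_zero le_rfl)).sub (hP0'.mul (h.tendsto_zero le_rfl))) hx
  obtain ⟨x₁, hx₁, hPx, hfx⟩ :=
    ((eventually_ge_atTop R).and (hpos.and (h.eventually_pos 0 le_rfl))).exists
  set c := P x₁ / f 0 x₁
  have hc : P x₁ - c * f 0 x₁ = 0 := sub_eq_zero.2 (div_mul_cancel₀ _ hfx.ne').symm
  have hc' : P' x₁ - c * f' 0 x₁ = 0 := by
    rw [sub_eq_zero, div_mul_eq_mul_div, eq_div_iff hfx.ne']
    linarith [hwronskian x₁ hx₁]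
  obtain ⟨hR, hR'⟩ := eq_zero_of_hasDerivAt_of_eq_zero_right hx₁ hK
    (w := fun x => P x - c * f 0 x) (w' := fun x => P' x - c * f' 0 x) (by fun_prop) (by fun_prop)
    (fun x hx => (hP x hx).sub ((hf x).const_mul c))
    (fun x hx => ((hP' x hx).sub ((hf' x hx).const_mul c)).congr_deriv (by ring)) hc hc'
  exact ⟨c, div_pos hPx hfx, sub_eq_zero.1 hR, sub_eq_zero.1 hR'⟩

theorem abs_sub_le_of_abs_deriv_le_exp {u p : ℝ → ℝ} {a C κ x : ℝ} (hκ : 0 < κ)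
    (hd : ∀ y, x ≤ y → HasDerivAt u (p y) y) (hp : ∀ y, x ≤ y → |p y| ≤ C * Real.exp (-κ * y))
    (hpm : AEStronglyMeasurable p (volume.restrict (Ioi x))) (hu : Tendsto u atTop (𝓝 a)) :
    |u x - a| ≤ C / κ * Real.exp (-κ * x) := by
  have hexp : IntegrableOn (fun y => C * Real.exp (-κ * y)) (Ioi x) :=
    (integrableOn_exp_mul_Ioi (neg_lt_zero.2 hκ) x).const_mul C
  have hle : ∀ᵐ y ∂volume.restrict (Ioi x), ‖p y‖ ≤ C * Real.exp (-κ * y) :=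
    (ae_restrict_iff' measurableSet_Ioi).2 (Eventually.of_forall fun y hy => hp y (le_of_lt hy))
  have hint := integral_Ioi_of_hasDerivAt_of_tendsto' hd (hexp.mono' hpm hle) hu
  rw [abs_sub_comm, ← hint]
  refine (norm_integral_le_of_norm_le hexp hle).trans_eq ?_
  rw [integral_const_mul, integral_exp_mul_Ioi (neg_lt_zero.2 hκ)]
  field_simp

theorem exists_sign_eventually_pos {p : ℝ → ℝ} (hp : Continuous p)
    (h : ∀ᶠ x in atTop, p x ≠ 0) :
    ∃ σ : ℝ, (σ = 1 ∨ σ = -1) ∧ ∀ᶠ x in atTop, 0 < σ * p x := by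
  obtain ⟨R, hR⟩ := eventually_atTop.1 h
  have hpos : ∀ x ∈ Ici R, ∀ y ∈ Ici R, 0 < p x → 0 < p y := fun x hx y hy hpx => by
    by_contra! hle
    obtain ⟨z, hz, hz0⟩ :=
      isPreconnected_Ici.intermediate_value hy hx hp.continuousOn ⟨hle, hpx.le⟩
    exact hR z hz hz0
  rcases lt_or_gt_of_ne (hR R le_rfl) with hneg | hpR
  · refine ⟨-1, Or.inr rfl, (eventually_ge_atTop R).mono fun x hx => ?_⟩
    rw [neg_one_mul, neg_pos]
    exact (hR x hx).lt_of_le (not_lt.1 fun h => hneg.not_gt (hpos x hx R self_mem_Ici h))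
  · refine ⟨1, Or.inl rfl, (eventually_ge_atTop R).mono fun x hx => ?_⟩
    rw [one_mul]
    exact hpos R self_mem_Ici x hx hpR

/-! ### Variation of integral curves -/

theorem exists_lipschitzOnWith_closedBall {E F : Type*} [NormedAddCommGroup E] [NormedSpace ℝ E]
    [ProperSpace E] [NormedAddCommGroup F] [NormedSpace ℝ F] {f : E → F} (hf : ContDiff ℝ 1 f)
    (x : E) (r : ℝ) : ∃ K, LipschitzOnWith K f (Metric.closedBall x r) :=
  hf.locallyLipschitz.locallyLipschitzOn.exists_lipschitzOnWith_of_compact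
    (isCompact_closedBall x r)

section IntegralCurve

variable {E : Type*} [NormedAddCommGroup E] [NormedSpace ℝ E] {v : E → E} {X Z : ℝ → E}
  {a b r t : ℝ} {K : NNReal}

theorem hasDerivWithinAt_Ici_of_isIntegralCurveOn {w : ℝ → E → E}
    (hX : IsIntegralCurveOn X w (Icc a b)) (ht : t ∈ Ico a b) :
    HasDerivWithinAt X (w t (X t)) (Ici t) t :=
  ((hX t (Ico_subset_Icc_self ht)).mono (Icc_subset_Icc_left ht.1)).mono_of_mem_nhdsWithin
    (Icc_mem_nhdsGE_of_mem (left_mem_Ico.2 ht.2))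

theorem dist_le_of_isIntegralCurveOn
    (hv : ∀ t ∈ Ico a b, LipschitzOnWith K v (Metric.closedBall (X t) r))
    (hX : IsIntegralCurveOn X (fun _ => v) (Icc a b))
    (hZ : IsIntegralCurveOn Z (fun _ => v) (Icc a b))
    (hr : ∀ t ∈ Ico a b, dist (Z t) (X t) ≤ r) (ht : t ∈ Icc a b) :
    dist (Z t) (X t) ≤ dist (Z a) (X a) * Real.exp (K * (t - a)) :=
  dist_le_of_trajectories_ODE_of_mem (v := fun _ => v) (s := fun t => Metric.closedBall (X t) r)
    hv hZ.continuousOn (fun _ hs => hasDerivWithinAt_Ici_of_isIntegralCurveOn hZ hs) hr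
    hX.continuousOn (fun _ hs => hasDerivWithinAt_Ici_of_isIntegralCurveOn hX hs)
    (fun s hs => Metric.mem_closedBall_self (dist_nonneg.trans (hr s hs))) le_rfl t ht

theorem dist_lt_of_isIntegralCurveOn
    (hv : ∀ t ∈ Ico a b, LipschitzOnWith K v (Metric.closedBall (X t) r))
    (hX : IsIntegralCurveOn X (fun _ => v) (Icc a b))
    (hZ : IsIntegralCurveOn Z (fun _ => v) (Icc a b))
    (h0 : dist (Z a) (X a) * Real.exp (K * (b - a)) < r) (ht : t ∈ Icc a b) :
    dist (Z t) (X t) < r := by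
  by_contra! hcon
  have hclosed : IsClosed {t ∈ Icc a b | r ≤ dist (Z t) (X t)} :=
    isClosed_Icc.isClosed_le continuousOn_const
      (continuous_dist.comp_continuousOn (hZ.continuousOn.prodMk hX.continuousOn))
  obtain ⟨T, ⟨hT, hrT⟩, hmin⟩ := (isCompact_Icc.of_isClosed_subset hclosed
    (sep_subset _ _)).exists_isLeast ⟨t, ht, hcon⟩
  have hbefore : ∀ s ∈ Ico a T, dist (Z s) (X s) ≤ r := fun s hs => by
    by_contra! hlt
    exact (hmin ⟨⟨hs.1, hs.2.le.trans hT.2⟩, hlt.le⟩).not_gt hs.2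
  have hsub : Icc a T ⊆ Icc a b := Icc_subset_Icc_right hT.2
  have hgrowth := dist_le_of_isIntegralCurveOn
    (fun s hs => hv s (Ico_subset_Ico_right hT.2 hs)) (hX.mono hsub) (hZ.mono hsub) hbefore
    (right_mem_Icc.2 hT.1)
  refine (hrT.trans (hgrowth.trans ?_)).not_gt h0
  gcongr
  exact hT.2

theorem exists_pos_forall_dist_le_mul_of_isIntegralCurveOn [ProperSpace E] (hv : ContDiff ℝ 1 v)
    (hX : IsIntegralCurveOn X (fun _ => v) (Icc a b)) :
    ∃ A : ℝ, 0 < A ∧ ∀ c ∈ Icc a b, ∀ Z : ℝ → E, IsIntegralCurveOn Z (fun _ => v) (Icc a c) →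
      dist (Z a) (X a) < A⁻¹ → ∀ t ∈ Icc a c, dist (Z t) (X t) ≤ dist (Z a) (X a) * A := by
  obtain ⟨R, hR⟩ := isCompact_Icc.exists_bound_of_continuousOn hX.continuousOn
  obtain ⟨K, hK⟩ := exists_lipschitzOnWith_closedBall hv 0 (R + 1)
  refine ⟨Real.exp (K * (b - a)), Real.exp_pos _, fun c hc Z hZ hsmall t ht => ?_⟩
  have hsub : Icc a c ⊆ Icc a b := Icc_subset_Icc_right hc.2
  have hlip : ∀ t ∈ Ico a c, LipschitzOnWith K v (Metric.closedBall (X t) 1) := fun t ht =>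
    hK.mono (Metric.closedBall_subset_closedBall' (by
      rw [dist_zero_right, add_comm]
      gcongr
      exact hR t (hsub (Ico_subset_Icc_self ht))))
  have hlt : ∀ t ∈ Icc a c, dist (Z t) (X t) < 1 := fun t ht => by
    refine dist_lt_of_isIntegralCurveOn hlip (hX.mono hsub) hZ ?_ ht
    rw [← lt_div_iff₀ (Real.exp_pos _), one_div]
    exact hsmall.trans_le (inv_anti₀ (Real.exp_pos _) (by gcongr; exact hc.2))
  refine (dist_le_of_isIntegralCurveOn hlip (hX.mono hsub) hZ
    (fun t ht => (hlt t (Ico_subset_Icc_self ht)).le) ht).trans ?_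
  gcongr
  exact ht.2.trans hc.2

end IntegralCurve

theorem abs_taylor_one_le {Φ : ℝ → ℝ} {s : Set ℝ} {K : NNReal} {y z : ℝ}
    (hΦ : Differentiable ℝ Φ) (hs : Convex ℝ s) (hK : LipschitzOnWith K (deriv Φ) s)
    (hy : y ∈ s) (hz : z ∈ s) :
    |Φ z - Φ y - deriv Φ y * (z - y)| ≤ K * |z - y| ^ 2 := by
  have hd : ∀ x, HasDerivAt (fun x => Φ x - deriv Φ y * x) (deriv Φ x - deriv Φ y) x := fun x =>
    ((hΦ x).hasDerivAt.sub ((hasDerivAt_id x).const_mul (deriv Φ y))).congr_deriv (by ring)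
  have hsub : uIcc y z ⊆ s := segment_eq_uIcc y z ▸ hs.segment_subset hy hz
  have hbound : ∀ x ∈ uIcc y z, ‖deriv Φ x - deriv Φ y‖ ≤ K * |z - y| := fun x hx =>
    (hK.norm_sub_le (hsub hx) hy).trans
      (mul_le_mul_of_nonneg_left (abs_sub_left_of_mem_uIcc hx) K.2)
  have key := (convex_uIcc y z).norm_image_sub_le_of_norm_hasDerivWithin_le
    (fun x _ => (hd x).hasDerivWithinAt) hbound left_mem_uIcc right_mem_uIcc
  rw [Real.norm_eq_abs, Real.norm_eq_abs, mul_assoc, ← sq] at key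
  convert key using 2
  ring

/-- The vector field on the phase plane of Newton's equation `y'' = -Φ(y)`. -/
def newtonField (Φ : ℝ → ℝ) (p : ℝ × ℝ) : ℝ × ℝ :=
  (p.2, -Φ p.1)

theorem contDiff_newtonField {Φ : ℝ → ℝ} {n : WithTop ℕ∞} (hΦ : ContDiff ℝ n Φ) :
    ContDiff ℝ n (newtonField Φ) :=
  contDiff_snd.prodMk (hΦ.comp contDiff_fst).neg

/-- The symplectic form of the phase plane; for phase points `(y, y')` and `(z, z')` of two
functions it is their Wronskian. -/
def symplecticForm (p q : ℝ × ℝ) : ℝ :=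
  p.1 * q.2 - p.2 * q.1

theorem hasDerivWithinAt_symplecticForm {P Q : ℝ → ℝ × ℝ} {P' Q' : ℝ × ℝ} {s : Set ℝ} {t : ℝ}
    (hP : HasDerivWithinAt P P' s t) (hQ : HasDerivWithinAt Q Q' s t) :
    HasDerivWithinAt (fun t => symplecticForm (P t) (Q t))
      (symplecticForm P' (Q t) + symplecticForm (P t) Q') s t := by
  have hfst : ∀ {F : ℝ → ℝ × ℝ} {d}, HasDerivWithinAt F d s t →
      HasDerivWithinAt (fun t => (F t).1) d.1 s t := fun hF => by
    simpa using hF.hasFDerivWithinAt.fst.hasDerivWithinAt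
  have hsnd : ∀ {F : ℝ → ℝ × ℝ} {d}, HasDerivWithinAt F d s t →
      HasDerivWithinAt (fun t => (F t).2) d.2 s t := fun hF => by
    simpa using hF.hasFDerivWithinAt.snd.hasDerivWithinAt
  refine (((hfst hP).mul (hsnd hQ)).sub ((hsnd hP).mul (hfst hQ))).congr_deriv ?_
  simp only [symplecticForm]
  ring

section Variation

variable {Φ : ℝ → ℝ} {X Y Z : ℝ → ℝ × ℝ} {a b t : ℝ}

theorem hasDerivWithinAt_symplecticForm_sub {s : Set ℝ}
    (hX : IsIntegralCurveOn X (fun _ => newtonField Φ) s)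
    (hZ : IsIntegralCurveOn Z (fun _ => newtonField Φ) s)
    (hY : IsIntegralCurveOn Y (fun t => newtonField fun w => deriv Φ (X t).1 * w) s) (ht : t ∈ s) :
    HasDerivWithinAt (fun t => symplecticForm (Z t - X t) (Y t))
      ((Φ (Z t).1 - Φ (X t).1 - deriv Φ (X t).1 * ((Z t).1 - (X t).1)) * (Y t).1) s t := by
  refine (hasDerivWithinAt_symplecticForm ((hZ t ht).sub (hX t ht)) (hY t ht)).congr_deriv ?_
  simp only [symplecticForm, newtonField, Pi.sub_apply, Prod.fst_sub, Prod.snd_sub]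
  ring

theorem exists_abs_symplecticForm_sub_le (hΦ : ContDiff ℝ 2 Φ)
    (hX : IsIntegralCurveOn X (fun _ => newtonField Φ) (Icc a b))
    (hY : IsIntegralCurveOn Y (fun t => newtonField fun w => deriv Φ (X t).1 * w) (Icc a b)) :
    ∃ C ε : ℝ, 0 < ε ∧ ∀ c ∈ Icc a b, ∀ Z : ℝ → ℝ × ℝ,
      IsIntegralCurveOn Z (fun _ => newtonField Φ) (Icc a c) → dist (Z a) (X a) < ε →
      |symplecticForm (Z c - X c) (Y c) - symplecticForm (Z a - X a) (Y a)| ≤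
        C * dist (Z a) (X a) ^ 2 := by
  obtain ⟨A, hA, hdist⟩ := exists_pos_forall_dist_le_mul_of_isIntegralCurveOn
    (contDiff_newtonField (hΦ.of_le one_le_two)) hX
  obtain ⟨R, hR⟩ := isCompact_Icc.exists_bound_of_continuousOn hX.continuousOn
  obtain ⟨M, hM⟩ := isCompact_Icc.exists_bound_of_continuousOn hY.continuousOn
  obtain ⟨K, hK⟩ := exists_lipschitzOnWith_closedBall (hΦ.deriv' (n := 1)) 0 (R + 1)
  refine ⟨K * A ^ 2 * |M| * (b - a), A⁻¹, inv_pos.2 hA, fun c hc Z hZ hε => ?_⟩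
  have hsub : Icc a c ⊆ Icc a b := Icc_subset_Icc_right hc.2
  have hbound : ∀ t ∈ Icc a c, ‖(Φ (Z t).1 - Φ (X t).1 - deriv Φ (X t).1 * ((Z t).1 - (X t).1)) *
      (Y t).1‖ ≤ K * (dist (Z a) (X a) * A) ^ 2 * |M| := by
    intro t ht
    have hfst : ‖(Z t).1 - (X t).1‖ ≤ dist (Z a) (X a) * A :=
      (le_max_left _ _).trans (hdist c hc Z hZ hε t ht)
    have hone : dist (Z a) (X a) * A < 1 := (lt_div_iff₀ hA).1 (by rwa [one_div])
    have hXt : ‖(X t).1‖ ≤ R := (norm_fst_le _).trans (hR t (hsub ht))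
    have hXmem : (X t).1 ∈ Metric.closedBall 0 (R + 1) := mem_closedBall_zero_iff.2 (by linarith)
    have hZmem : (Z t).1 ∈ Metric.closedBall 0 (R + 1) :=
      mem_closedBall_zero_iff.2 (by linarith [norm_le_norm_add_norm_sub' (Z t).1 (X t).1])
    have hYt : ‖(Y t).1‖ ≤ |M| := (norm_fst_le _).trans ((hM t (hsub ht)).trans (le_abs_self M))
    rw [norm_mul]
    gcongr
    exact (abs_taylor_one_le (hΦ.differentiable two_ne_zero) (convex_closedBall 0 (R + 1))
      hK hXmem hZmem).trans (by gcongr; exact hfst)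
  have hmean := (convex_Icc a c).norm_image_sub_le_of_norm_hasDerivWithin_le
    (fun t ht => hasDerivWithinAt_symplecticForm_sub (hX.mono hsub) hZ (hY.mono hsub) ht)
    hbound (left_mem_Icc.2 hc.1) (right_mem_Icc.2 hc.1)
  refine hmean.trans ?_
  rw [Real.norm_of_nonneg (sub_nonneg.2 hc.1)]
  calc _ ≤ K * (dist (Z a) (X a) * A) ^ 2 * |M| * (b - a) := by gcongr; exact hc.2
    _ = _ := by ring

end Variation

/-- The Hamiltonian `p² / 2 + A(u)` of the phase point `(u, p)` for the potential `A`. -/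
def phaseEnergy (A : ℝ → ℝ) (p : ℝ × ℝ) : ℝ :=
  p.2 ^ 2 / 2 + A p.1

theorem hasDerivAt_of_hasDerivAt_sq {P : ℝ → ℝ} {d x : ℝ} (hP : ContinuousAt P x) (h0 : P x ≠ 0)
    (hd : HasDerivAt (fun y => P y ^ 2) d x) : HasDerivAt P (d / (2 * P x)) x := by
  have hsum : Tendsto (fun y => P y + P x) (𝓝[≠] x) (𝓝 (2 * P x)) := by
    rw [two_mul]
    exact (hP.tendsto.mono_left nhdsWithin_le_nhds).add_const _
  have hne : 2 * P x ≠ 0 := mul_ne_zero two_ne_zero h0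
  rw [hasDerivAt_iff_tendsto_slope] at hd ⊢
  refine (hd.div hsum hne).congr' ?_
  filter_upwards [hsum.eventually_ne hne] with y hy
  simp only [slope_def_field, Pi.div_apply]
  rw [div_right_comm, sq_sub_sq, mul_div_cancel_left₀ _ hy]

theorem hasDerivAt_of_phaseEnergy_eq {A B : ℝ → ℝ} {Q : ℝ → ℝ × ℝ} {a g A' B' : ℝ}
    (hQ : ContinuousAt Q g) (hA : HasDerivAt A A' (Q g).1) (hB : HasDerivAt B B' (Q g).1)
    (hAE : ∀ᶠ y in 𝓝 g, phaseEnergy A (Q y) = a) (hBE : ∀ᶠ y in 𝓝 g, phaseEnergy B (Q y) = y)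
    (h0 : (Q g).2 * (B' - A') ≠ 0) :
    HasDerivAt Q (((Q g).2 * (B' - A'))⁻¹ • ((Q g).2, -A')) g := by
  have hQ0 : (Q g).2 ≠ 0 := left_ne_zero_of_mul h0
  have hfst : HasDerivAt (fun y => (Q y).1) (B' - A')⁻¹ g := by
    refine HasDerivAt.of_local_left_inverse (f := fun z => B z - A z + a) hQ.fst
      ((hB.sub hA).add_const a) (right_ne_zero_of_mul h0) ?_
    filter_upwards [hAE, hBE] with y hAy hBy
    simp only [phaseEnergy] at hAy hBy
    linarith
  have hsq : HasDerivAt (fun y => (Q y).2 ^ 2) (-2 * (A' * (B' - A')⁻¹)) g := by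
    refine (((hA.comp g hfst).const_sub a).const_mul 2).congr_of_eventuallyEq ?_ |>.congr_deriv ?_
    · filter_upwards [hAE] with y hy
      simp only [phaseEnergy] at hy
      simp only [Function.comp]
      linarith
    · ring
  refine (hfst.prodMk (hasDerivAt_of_hasDerivAt_sq hQ.snd hQ0 hsq)).congr_deriv ?_
  ext <;> simp only [Prod.smul_mk, smul_eq_mul, mul_inv] <;> field_simp

theorem uniqueDiffWithinAt_sublevel_of_deriv_ne_zero {L : ℝ → ℝ} {L' g : ℝ} {G : Set ℝ}
    (hG : G ∈ 𝓝 g) (hL : HasDerivAt L L' g) (hL' : L' ≠ 0) :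
    UniqueDiffWithinAt ℝ {y ∈ G | L y ≤ L g} g := by
  rw [uniqueDiffWithinAt_iff_accPt]
  rw [hasDerivAt_iff_tendsto_slope] at hL
  have of_side : ∀ s : Set ℝ, (𝓝[s] g).NeBot → s ⊆ {g}ᶜ → (∀ᶠ y in 𝓝[s] g, L y ≤ L g) →
      AccPt g (𝓟 {y ∈ G | L y ≤ L g}) := fun s hs hsub hle => by
    refine NeBot.mono hs (le_inf (nhdsWithin_mono g hsub) (le_principal_iff.2 ?_))
    filter_upwards [hle, nhdsWithin_le_nhds hG] with y hLy hy using ⟨hy, hLy⟩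
  rcases lt_or_gt_of_ne hL' with hneg | hpos
  · refine of_side (Ioi g) inferInstance (fun y hy => ne_of_gt hy) ?_
    filter_upwards [nhdsWithin_mono g (fun y hy => ne_of_gt hy) (hL.eventually (gt_mem_nhds hneg)),
      self_mem_nhdsWithin] with y hslope hy
    rw [slope_def_field, div_lt_iff₀ (sub_pos.2 hy), zero_mul] at hslope
    exact (sub_neg.1 hslope).le
  · refine of_side (Iio g) inferInstance (fun y hy => ne_of_lt hy) ?_
    filter_upwards [nhdsWithin_mono g (fun y hy => ne_of_lt hy) (hL.eventually (lt_mem_nhds hpos)),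
      self_mem_nhdsWithin] with y hslope hy
    rw [slope_def_field, lt_div_iff_of_neg (sub_neg.2 hy), zero_mul] at hslope
    exact (sub_neg.1 hslope).le

theorem hasDerivWithinAt_zero_of_abs_le_mul_dist_sq {E : Type*} [NormedAddCommGroup E]
    [NormedSpace ℝ E] {F : ℝ → ℝ} {Q : ℝ → E} {D : E} {C g : ℝ} {s : Set ℝ}
    (hQ : HasDerivAt Q D g) (hF : ∀ᶠ y in 𝓝[s] g, |F y| ≤ C * dist (Q y) (Q g) ^ 2)
    (h0 : F g = 0) : HasDerivWithinAt F 0 s g := by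
  rw [hasDerivWithinAt_iff_isLittleO]
  simp only [h0, sub_zero, smul_zero]
  have hsq : (fun y => dist (Q y) (Q g) ^ 2) =O[𝓝 g] fun y => ‖y - g‖ ^ 2 := by
    simp only [dist_eq_norm]
    exact hQ.isBigO_sub.norm_norm.pow 2
  refine (Asymptotics.IsBigO.of_bound |C| ?_).trans_isLittleO
    ((hsq.trans_isLittleO (Asymptotics.isLittleO_pow_sub_sub g one_lt_two)).mono
      nhdsWithin_le_nhds)
  filter_upwards [hF] with y hy
  rw [Real.norm_eq_abs, Real.norm_eq_abs, ← abs_mul]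
  exact hy.trans (le_abs_self _)

section EndpointVariation

variable {Φ : ℝ → ℝ} {Z : ℝ → ℝ → ℝ × ℝ} {Y : ℝ → ℝ × ℝ} {T : ℝ → ℝ} {a g T' : ℝ}
  {D₀ D₁ : ℝ × ℝ} {s : Set ℝ}

theorem hasDerivWithinAt_symplecticForm_endpoint
    (hX : HasDerivWithinAt (Z g) (newtonField Φ (Z g (T g))) (Icc a (T g)) (T g))
    {Y' : ℝ × ℝ} (hY : HasDerivWithinAt Y Y' (Icc a (T g)) (T g))
    (hT : HasDerivAt T T' g) (hD₁ : HasDerivAt (fun y => Z y (T y)) D₁ g)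
    (hs : ∀ y ∈ s, T y ∈ Icc a (T g)) :
    HasDerivWithinAt (fun y => symplecticForm (Z y (T y) - Z g (T y)) (Y (T y)))
      (symplecticForm (D₁ - T' • newtonField Φ (Z g (T g))) (Y (T g))) s g := by
  have hXT : HasDerivWithinAt (fun y => Z g (T y)) _ s g :=
    hX.scomp g hT.hasDerivWithinAt hs
  have hYT : HasDerivWithinAt (fun y => Y (T y)) _ s g := hY.scomp g hT.hasDerivWithinAt hs
  refine (hasDerivWithinAt_symplecticForm (hD₁.hasDerivWithinAt.sub hXT) hYT).congr_deriv ?_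
  simp [symplecticForm]

theorem symplecticForm_endpoint_variation_eq (hΦ : ContDiff ℝ 2 Φ)
    (hZ : ∀ᶠ y in 𝓝 g, IsIntegralCurveOn (Z y) (fun _ => newtonField Φ) (Icc a (T y)))
    (hY : IsIntegralCurveOn Y (fun t => newtonField fun w => deriv Φ (Z g t).1 * w)
      (Icc a (T g)))
    (haT : a < T g) (hT : HasDerivAt T T' g) (hT' : T' ≠ 0)
    (hD₀ : HasDerivAt (fun y => Z y a) D₀ g) (hD₁ : HasDerivAt (fun y => Z y (T y)) D₁ g) :
    symplecticForm (D₁ - T' • newtonField Φ (Z g (T g))) (Y (T g)) = symplecticForm D₀ (Y a) := by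
  set G : Set ℝ := {y | IsIntegralCurveOn (Z y) (fun _ => newtonField Φ) (Icc a (T y)) ∧ a ≤ T y}
  have hGg : G ∈ 𝓝 g := hZ.and (hT.continuousAt.eventually_const_le haT)
  set s : Set ℝ := {y ∈ G | T y ≤ T g}
  have hX := hZ.self_of_nhds
  have hright : T g ∈ Icc a (T g) := right_mem_Icc.2 haT.le
  have hend : HasDerivWithinAt (fun y => symplecticForm (Z y (T y) - Z g (T y)) (Y (T y)))
      (symplecticForm (D₁ - T' • newtonField Φ (Z g (T g))) (Y (T g))) s g :=
    hasDerivWithinAt_symplecticForm_endpoint (hX _ hright) (hY _ hright) hT hD₁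
      fun y hy => ⟨hy.1.2, hy.2⟩
  have hstart : HasDerivWithinAt (fun y => symplecticForm (Z y a - Z g a) (Y a))
      (symplecticForm D₀ (Y a)) s g :=
    (hasDerivWithinAt_symplecticForm (hD₀.sub_const (Z g a)).hasDerivWithinAt
      (hasDerivWithinAt_const g s (Y a))).congr_deriv (by simp [symplecticForm])
  obtain ⟨C, ε, hε, hC⟩ := exists_abs_symplecticForm_sub_le hΦ hX hY
  have hdiff : HasDerivWithinAt (fun y => symplecticForm (Z y (T y) - Z g (T y)) (Y (T y)) -
      symplecticForm (Z y a - Z g a) (Y a)) 0 s g := by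
    refine hasDerivWithinAt_zero_of_abs_le_mul_dist_sq (C := C) hD₀ ?_ (by simp [symplecticForm])
    filter_upwards [nhdsWithin_le_nhds (hD₀.continuousAt.eventually (Metric.ball_mem_nhds _ hε)),
      self_mem_nhdsWithin] with y hy hys
    exact hC (T y) ⟨hys.1.2, hys.2⟩ (Z y) hys.1.1 hy
  exact sub_eq_zero.1 ((uniqueDiffWithinAt_sublevel_of_deriv_ne_zero hGg hT hT').eq_deriv s
    (hend.sub hstart) hdiff)

end EndpointVariation

/-! ### Stationary fronts -/

theorem hasDerivWithinAt_Icc_of_hasDerivAt_Ioo {F G : ℝ → ℝ} {a b : ℝ} (hab : a < b)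
    (hF : Continuous F) (hG : Continuous G) (hd : ∀ x ∈ Ioo a b, HasDerivAt F (G x) x)
    {x : ℝ} (hx : x ∈ Icc a b) : HasDerivWithinAt F (G x) (Icc a b) x := by
  have hdiff : DifferentiableOn ℝ F (Ioo a b) := fun y hy =>
    (hd y hy).differentiableAt.differentiableWithinAt
  have hlim : ∀ {s : Set ℝ}, Ioo a b ∈ 𝓝[s] x → Tendsto (deriv F) (𝓝[s] x) (𝓝 (G x)) :=
    fun hs => hG.continuousWithinAt.congr' ((eventually_of_mem hs) fun y hy => (hd y hy).deriv.symm)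
  rcases hx.1.eq_or_lt with rfl | hax
  · exact (hasDerivWithinAt_Ici_of_tendsto_deriv hdiff hF.continuousWithinAt
      (Ioo_mem_nhdsGT hab) (hlim (Ioo_mem_nhdsGT hab))).mono Icc_subset_Ici_self
  rcases hx.2.eq_or_lt with rfl | hxb
  · exact (hasDerivWithinAt_Iic_of_tendsto_deriv hdiff hF.continuousWithinAt
      (Ioo_mem_nhdsLT hab) (hlim (Ioo_mem_nhdsLT hab))).mono Icc_subset_Iic_self
  · exact (hd x ⟨hax, hxb⟩).hasDerivWithinAt

theorem exists_abs_le_of_tendsto {F : ℝ → ℝ} {a b : ℝ} (hF : Continuous F)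
    (ha : Tendsto F atBot (𝓝 a)) (hb : Tendsto F atTop (𝓝 b)) : ∃ K, ∀ x, |F x| ≤ K := by
  obtain ⟨x₁, hx₁⟩ := eventually_atBot.1 (ha.abs.eventually (gt_mem_nhds (lt_add_one |a|)))
  obtain ⟨x₂, hx₂⟩ := eventually_atTop.1 (hb.abs.eventually (gt_mem_nhds (lt_add_one |b|)))
  obtain ⟨K, hK⟩ := isCompact_Icc.exists_bound_of_continuousOn (s := Icc x₁ x₂) hF.continuousOn
  refine ⟨max K (max (|a| + 1) (|b| + 1)), fun x => ?_⟩
  rcases le_total x x₁ with h₁ | h₁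
  · exact (hx₁ x h₁).le.trans (le_max_of_le_right (le_max_left _ _))
  rcases le_total x x₂ with h₂ | h₂
  · exact (hK x ⟨h₁, h₂⟩).trans (le_max_left _ _)
  · exact (hx₂ x h₂).le.trans (le_max_of_le_right (le_max_right _ _))

theorem abs_le_mul_exp_of_abs_le {F : ℝ → ℝ} {C K R κ : ℝ} (hκ : 0 ≤ κ) (hC : 0 ≤ C)
    (hK : ∀ x, |F x| ≤ K) (hF : ∀ x, R < x → |F x| ≤ C * Real.exp (-κ * x)) (x : ℝ) :
    |F x| ≤ (C + K * Real.exp (κ * R)) * Real.exp (-κ * x) := by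
  have hK0 : 0 ≤ K := (abs_nonneg _).trans (hK x)
  rw [add_mul, mul_assoc, ← Real.exp_add]
  rcases lt_or_ge R x with hx | hx
  · exact (hF x hx).trans (le_add_of_nonneg_right (by positivity))
  · have hexp : 1 ≤ Real.exp (κ * R + -κ * x) := Real.one_le_exp (by nlinarith)
    exact (hK x).trans <| (le_mul_of_one_le_right hK0 hexp).trans <|
      le_add_of_nonneg_left (by positivity)

theorem contDiff_deriv_deriv {W : ℝ → ℝ} {n : WithTop ℕ∞} (hW : ContDiff ℝ (n + 2) W) :
    ContDiff ℝ n (deriv (deriv W)) :=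
  ContDiff.deriv' (ContDiff.deriv' (by rwa [add_assoc, one_add_one_eq_two]))

/-- The curve `(u, u_x)` of a function in the phase plane. -/
def phasePoint (u : ℝ → ℝ) (x : ℝ) : ℝ × ℝ :=
  (u x, deriv u x)

theorem hasDerivAt_phaseEnergy_phasePoint {A u : ℝ → ℝ} {x : ℝ}
    (hA : DifferentiableAt ℝ A (u x)) (hu : DifferentiableAt ℝ u x)
    (hode : HasDerivAt (deriv u) (-deriv A (u x)) x) :
    HasDerivAt (fun y => phaseEnergy A (phasePoint u y)) 0 x := by
  have hpot := hA.hasDerivAt.comp x hu.hasDerivAt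
  refine (((hode.pow 2).div_const 2).add hpot).congr_deriv ?_
  push_cast
  ring

namespace PiecewisePotential

variable (V : PiecewisePotential) {L x : ℝ} (w : ℝ)

/-- The potential with the left and the right interval interchanged; it turns statements about the
right interval into statements about the left one. -/
def swap : PiecewisePotential :=
  ⟨V.Vr, V.Vm, V.Vl, V.contDiff_r, V.contDiff_m, V.contDiff_l⟩

theorem contDiff_deriv_Vm : ContDiff ℝ 2 (deriv V.Vm) := ContDiff.deriv' (n := 2) V.contDiff_m

theorem contDiff_deriv_Vr : ContDiff ℝ 2 (deriv V.Vr) := ContDiff.deriv' (n := 2) V.contDiff_r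

theorem du_middle (h₁ : -L ≤ x) (h₂ : x ≤ L) : V.du L w x = deriv V.Vm w := by
  simp [du, val, not_lt.2 h₁, h₂]

theorem du_right (hL : 0 < L) (hx : L < x) : V.du L w x = deriv V.Vr w := by
  simp [du, val, not_lt.2 (show -L ≤ x by linarith), not_le.2 hx]

theorem duu_eq : V.duu L w x = if x < -L then deriv (deriv V.Vl) w else
    if x ≤ L then deriv (deriv V.Vm) w else deriv (deriv V.Vr) w := by
  unfold duu val
  split_ifs <;> simp [iteratedDeriv_succ, iteratedDeriv_zero]

theorem duu_middle (h₁ : -L ≤ x) (h₂ : x ≤ L) : V.duu L w x = deriv (deriv V.Vm) w := by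
  rw [duu_eq, if_neg (not_lt.2 h₁), if_pos h₂]

theorem duu_right (hL : 0 < L) (hx : L < x) : V.duu L w x = deriv (deriv V.Vr) w := by
  rw [duu_eq, if_neg (not_lt.2 (by linarith)), if_neg (not_le.2 hx)]

theorem swap_val (hL : 0 < L) : V.swap.val L w x = V.val L w (-x) := by
  simp only [val, swap]
  split_ifs <;> first | rfl | linarith

theorem swap_du (hL : 0 < L) : V.swap.du L w x = V.du L w (-x) := by
  simp only [du, swap_val V _ hL]

theorem swap_duu (hL : 0 < L) : V.swap.duu L w x = V.duu L w (-x) := by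
  simp only [duu, swap_val V _ hL]

end PiecewisePotential

namespace IsStationaryFront

variable {V : PiecewisePotential} {L um up : ℝ} {u : ℝ → ℝ}

theorem differentiable (h : IsStationaryFront V L um up u) : Differentiable ℝ u :=
  h.contDiff.differentiable one_ne_zero

theorem continuous (h : IsStationaryFront V L um up u) : Continuous u :=
  h.contDiff.continuous

theorem continuous_deriv (h : IsStationaryFront V L um up u) : Continuous (deriv u) :=
  h.contDiff.continuous_deriv le_rfl

theorem reflect (h : IsStationaryFront V L um up u) (hL : 0 < L) :
    IsStationaryFront V.swap L up um (fun x => u (-x)) where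
  contDiff := h.contDiff.comp contDiff_neg
  ode := fun x h₁ h₂ => by
    rw [funext (deriv_comp_neg u), V.swap_du _ hL]
    exact (hasDerivAt_comp_neg (h.ode (-x) (by contrapose! h₂; linarith)
      (by contrapose! h₁; linarith))).neg.congr_deriv (by ring)
  decay := by
    obtain ⟨C, κ, hκ, hb⟩ := h.decay
    refine ⟨C, κ, hκ, fun x => ?_⟩
    rw [deriv_comp_neg, abs_neg, ← abs_neg x]
    exact hb (-x)
  tendsto_atBot := h.tendsto_atTop.comp tendsto_neg_atBot_atTop
  tendsto_atTop := h.tendsto_atBot.comp tendsto_neg_atTop_atBot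

theorem tendsto_deriv_atTop (h : IsStationaryFront V L um up u) :
    Tendsto (deriv u) atTop (𝓝 0) := by
  obtain ⟨C, κ, hκ, hb⟩ := h.decay
  refine squeeze_zero_norm' ?_ (tendsto_mul_exp_neg_mul_atTop C hκ)
  filter_upwards [eventually_ge_atTop 0] with x hx
  simpa [abs_of_nonneg hx] using hb x

theorem exists_abs_sub_le_exp (h : IsStationaryFront V L um up u) :
    ∃ C κ : ℝ, 0 ≤ C ∧ 0 < κ ∧ ∀ x, 0 ≤ x → |u x - up| ≤ C * Real.exp (-κ * x) := by
  obtain ⟨C, κ, hκ, hb⟩ := h.decay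
  have hC : 0 ≤ C := by simpa using (abs_nonneg _).trans (hb 0)
  refine ⟨C / κ, κ, by positivity, hκ, fun x hx => abs_sub_le_of_abs_deriv_le_exp hκ
    (fun y _ => h.differentiable.differentiableAt.hasDerivAt) (fun y hy => ?_)
    h.continuous_deriv.aestronglyMeasurable h.tendsto_atTop⟩
  simpa [abs_of_nonneg (hx.trans hy)] using hb y

theorem exists_abs_duu_le (h : IsStationaryFront V L um up u) :
    ∃ K, ∀ x, |V.duu L (u x) x| ≤ K := by
  have hbound : ∀ W : ℝ → ℝ, ContDiff ℝ 3 W → ∃ K, ∀ x, |deriv (deriv W) (u x)| ≤ K :=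
    fun W hW => by
      have hc : Continuous (deriv (deriv W)) := (contDiff_deriv_deriv (n := 1) hW).continuous
      exact exists_abs_le_of_tendsto (hc.comp h.continuous)
        ((hc.tendsto um).comp h.tendsto_atBot) ((hc.tendsto up).comp h.tendsto_atTop)
  obtain ⟨Kl, hKl⟩ := hbound V.Vl V.contDiff_l
  obtain ⟨Km, hKm⟩ := hbound V.Vm V.contDiff_m
  obtain ⟨Kr, hKr⟩ := hbound V.Vr V.contDiff_r
  refine ⟨max Kl (max Km Kr), fun x => ?_⟩
  rw [V.duu_eq]
  split_ifs
  · exact (hKl x).trans (le_max_left _ _)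
  · exact (hKm x).trans (le_max_of_le_right (le_max_left _ _))
  · exact (hKr x).trans (le_max_of_le_right (le_max_right _ _))

theorem measurable_duu (h : IsStationaryFront V L um up u) :
    Measurable fun x => V.duu L (u x) x := by
  have hm : ∀ W : ℝ → ℝ, Measurable fun x => deriv (deriv W) (u x) := fun W =>
    (measurable_deriv _).comp h.continuous.measurable
  simp only [V.duu_eq]
  exact (hm V.Vl).ite measurableSet_Iio ((hm V.Vm).ite measurableSet_Iic (hm V.Vr))

theorem continuousAt_duu (h : IsStationaryFront V L um up u) {x : ℝ}
    (hx : x ∉ ({-L, L} : Set ℝ)) : ContinuousAt (fun x => V.duu L (u x) x) x := by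
  simp only [mem_insert_iff, mem_singleton_iff, not_or] at hx
  have hc : ∀ W : ℝ → ℝ, ContDiff ℝ 3 W → ContinuousAt (fun x => deriv (deriv W) (u x)) x :=
    fun W hW => ((contDiff_deriv_deriv (n := 1) hW).continuous.comp h.continuous).continuousAt
  simp only [V.duu_eq]
  rcases lt_or_gt_of_ne hx.1 with ha | ha
  · refine (hc V.Vl V.contDiff_l).congr ?_
    filter_upwards [gt_mem_nhds ha] with y hy
    simp [hy]
  rcases lt_or_gt_of_ne hx.2 with hb | hb
  · refine (hc V.Vm V.contDiff_m).congr ?_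
    filter_upwards [lt_mem_nhds ha, gt_mem_nhds hb] with y hy hy'
    simp [not_lt.2 hy.le, hy'.le]
  · refine (hc V.Vr V.contDiff_r).congr ?_
    filter_upwards [lt_mem_nhds ha, lt_mem_nhds hb] with y hy hy'
    simp [not_lt.2 hy.le, not_le.2 hy']

theorem exists_abs_duu_sub_le_exp (h : IsStationaryFront V L um up u) (hL : 0 < L) :
    ∃ C κ : ℝ, 0 < κ ∧ ∀ x, |V.duu L (u x) x - deriv (deriv V.Vr) up| ≤
      C * Real.exp (-κ * x) := by
  obtain ⟨C, κ, hC, hκ, hb⟩ := h.exists_abs_sub_le_exp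
  obtain ⟨r, hr⟩ := exists_abs_le_of_tendsto (h.continuous.sub continuous_const)
    (h.tendsto_atBot.sub_const up) (h.tendsto_atTop.sub_const up)
  obtain ⟨K, hK⟩ := exists_lipschitzOnWith_closedBall
    (contDiff_deriv_deriv (n := 1) V.contDiff_r) up r
  obtain ⟨M, hM⟩ := h.exists_abs_duu_le
  refine ⟨_, κ, hκ, abs_le_mul_exp_of_abs_le (R := L) hκ.le (mul_nonneg K.2 hC)
    (fun x => (abs_sub _ _).trans (add_le_add_left (hM x) _)) fun x hx => ?_⟩
  rw [V.duu_right _ hL hx, mul_assoc]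
  exact (hK.dist_le_mul _ (hr x) _ (Metric.mem_closedBall_self ((abs_nonneg _).trans (hr x)))).trans
    (mul_le_mul_of_nonneg_left (hb x (hL.trans hx).le) K.2)

theorem hasDerivAt_deriv_right (h : IsStationaryFront V L um up u) (hL : 0 < L) {x : ℝ}
    (hx : L < x) : HasDerivAt (deriv u) (-deriv V.Vr (u x)) x := by
  rw [← V.du_right (u x) hL hx]
  exact h.ode x (by linarith) hx.ne'

theorem hasDerivAt_deriv_middle (h : IsStationaryFront V L um up u) {x : ℝ}
    (hx : x ∈ Ioo (-L) L) : HasDerivAt (deriv u) (-deriv V.Vm (u x)) x := by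
  rw [← V.du_middle (u x) hx.1.le hx.2.le]
  exact h.ode x hx.1.ne' hx.2.ne

theorem phaseEnergy_right (h : IsStationaryFront V L um up u) (hL : 0 < L) :
    phaseEnergy V.Vr (phasePoint u L) = V.Vr up := by
  have hu := h.continuous
  have hp := h.continuous_deriv
  have hV := V.contDiff_r.continuous
  refine eq_of_hasDerivAt_zero_of_tendsto (F := fun x => phaseEnergy V.Vr (phasePoint u x))
    (Continuous.continuousOn (by simp only [phaseEnergy, phasePoint]; fun_prop))
    (fun x hx => hasDerivAt_phaseEnergy_phasePoint
      (V.contDiff_r.differentiable (by norm_num)).differentiableAt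
      h.differentiable.differentiableAt (h.hasDerivAt_deriv_right hL hx)) ?_ le_rfl
  simpa [phaseEnergy, phasePoint] using
    ((h.tendsto_deriv_atTop.pow 2).div_const 2).add ((hV.tendsto up).comp h.tendsto_atTop)

theorem phaseEnergy_left (h : IsStationaryFront V L um up u) (hL : 0 < L) :
    phaseEnergy V.Vl (phasePoint u (-L)) = V.Vl um := by
  have hreflect := (h.reflect hL).phaseEnergy_right hL
  simpa only [phaseEnergy, phasePoint, deriv_comp_neg, neg_sq, PiecewisePotential.swap] using
    hreflect

theorem isIntegralCurveOn_phasePoint (h : IsStationaryFront V L um up u) (hL : 0 < L) :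
    IsIntegralCurveOn (phasePoint u) (fun _ => newtonField (deriv V.Vm)) (Icc (-L) L) :=
  fun _ ht => (h.differentiable.differentiableAt.hasDerivAt.hasDerivWithinAt).prodMk
    (hasDerivWithinAt_Icc_of_hasDerivAt_Ioo (by linarith) h.continuous_deriv
      (V.contDiff_deriv_Vm.continuous.comp h.continuous).neg
      (fun _ hx => h.hasDerivAt_deriv_middle hx) ht)

theorem tendsto_deriv_Vr_atTop (h : IsStationaryFront V L um up u) (hL : 0 < L) :
    Tendsto (fun x => deriv V.Vr (u x)) atTop (𝓝 0) := by
  have hlim : Tendsto (fun x => deriv V.Vr (u x)) atTop (𝓝 (deriv V.Vr up)) :=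
    (V.contDiff_deriv_Vr.continuous.tendsto up).comp h.tendsto_atTop
  have hzero : -deriv V.Vr up = 0 := eq_zero_of_tendsto_of_tendsto_deriv
    (fun x hx => h.hasDerivAt_deriv_right hL hx) h.tendsto_deriv_atTop hlim.neg
  rwa [neg_eq_zero.1 hzero] at hlim

/- Differentiating the front equation shows that `u_x` solves the linearised equation at `l = 0`,
which both forces hyperbolicity of the limit and identifies the Jost function. -/
theorem exists_isJostFamily (h : IsStationaryFront V L um up u) (hL : 0 < L) {σ : ℝ}
    (hpos : ∀ᶠ x in atTop, 0 < σ * deriv u x) :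
    ∃ f f' : ℝ → ℝ → ℝ, IsJostFamily (fun x => V.duu L (u x) x) {-L, L} f f' ∧
      ∃ c, 0 < c ∧ σ * deriv u L = c * f 0 L ∧ -(σ * deriv V.Vr (u L)) = c * f' 0 L := by
  obtain ⟨C, κ, hκ, hb⟩ := h.exists_abs_duu_sub_le_exp hL
  obtain ⟨K, hK⟩ := h.exists_abs_duu_le
  have hu := h.continuous
  have hp := h.continuous_deriv
  have hV := V.contDiff_deriv_Vr.continuous
  have hP : ∀ x, L < x → HasDerivAt (fun x => σ * deriv u x) (-(σ * deriv V.Vr (u x))) x :=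
    fun x hx => ((h.hasDerivAt_deriv_right hL hx).const_mul σ).congr_deriv (by ring)
  have hP' : ∀ x, L < x → HasDerivAt (fun x => -(σ * deriv V.Vr (u x)))
      (-(V.duu L (u x) x * (σ * deriv u x))) x := fun x hx => by
    have hcomp := (V.contDiff_deriv_Vr.differentiable two_ne_zero (u x)).hasDerivAt.comp x
      (h.differentiable x).hasDerivAt
    rw [V.duu_right _ hL hx]
    exact (hcomp.const_mul σ).neg.congr_deriv (by ring)
  have hP0 : Tendsto (fun x => σ * deriv u x) atTop (𝓝 0) := by
    simpa using h.tendsto_deriv_atTop.const_mul σ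
  have hP0' : Tendsto (fun x => -(σ * deriv V.Vr (u x))) atTop (𝓝 0) := by
    simpa using ((h.tendsto_deriv_Vr_atTop hL).const_mul σ).neg
  obtain ⟨f, f', hf⟩ := _root_.exists_isJostFamily (S := {-L, L}) (Set.to_countable _)
    h.measurable_duu (fun x hx => h.continuousAt_duu hx)
    (limit_neg_of_pos_decaying_solution hκ hb hP hP' hP0 hP0' hpos) hκ hb
  have hS : ∀ x, L < x → x ∉ ({-L, L} : Set ℝ) := fun x hx => by
    simp only [mem_insert_iff, mem_singleton_iff, not_or]
    exact ⟨by linarith, hx.ne'⟩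
  exact ⟨f, f', hf, hf.exists_pos_eq_mul hK hS (by fun_prop) (by fun_prop) hP hP' hP0 hP0' hpos⟩

theorem exists_isJostFamily_reflect (h : IsStationaryFront V L um up u) (hL : 0 < L) {τ : ℝ}
    (hpos : ∀ᶠ x in atTop, 0 < τ * deriv u (-x)) :
    ∃ k k' : ℝ → ℝ → ℝ, IsJostFamily (fun x => V.duu L (u (-x)) (-x)) {-L, L} k k' ∧
      ∃ d, 0 < d ∧ τ * deriv u (-L) = d * k 0 L ∧ τ * deriv V.Vl (u (-L)) = d * k' 0 L := by
  have hpos' : ∀ᶠ x in atTop, 0 < -τ * deriv (fun x => u (-x)) x := by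
    simpa only [deriv_comp_neg, neg_mul_neg] using hpos
  obtain ⟨k, k', hk, d, hd, hd₁, hd₂⟩ := (h.reflect hL).exists_isJostFamily hL hpos'
  simp only [V.swap_duu _ hL] at hk
  rw [deriv_comp_neg, neg_mul_neg] at hd₁
  rw [neg_mul, neg_neg] at hd₂
  exact ⟨k, k', hk, d, hd, hd₁, hd₂⟩

end IsStationaryFront

theorem isIntegralCurveOn_comp_sub_Icc {E : Type*} [NormedAddCommGroup E] [NormedSpace ℝ E]
    {γ : ℝ → E} {v : ℝ → E → E} {a b : ℝ} (h : IsIntegralCurveOn γ v (Icc a b)) (c : ℝ) :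
    IsIntegralCurveOn (fun t => γ (t - c)) (fun t => v (t - c)) (Icc (a + c) (b + c)) := by
  have hshift := h.comp_sub c
  rwa [← image_vadd, funext (vadd_eq_add c), image_const_add_Icc, add_comm c, add_comm c] at hshift

theorem symplecticForm_smul_sub_smul (a b : ℝ) (p q r : ℝ × ℝ) :
    symplecticForm (a • p - b • q) r = a * symplecticForm p r - b * symplecticForm q r := by
  simp only [symplecticForm, Prod.fst_sub, Prod.snd_sub, Prod.smul_fst, Prod.smul_snd, smul_eq_mul]
  ring

theorem symplecticForm_smul_self (a : ℝ) (p : ℝ × ℝ) : symplecticForm (a • p) p = 0 := by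
  simp only [symplecticForm, Prod.smul_fst, Prod.smul_snd, smul_eq_mul]
  ring

theorem IsStationaryFront.symplecticForm_newtonField_eq {V : PiecewisePotential} {L um up : ℝ}
    {u : ℝ → ℝ} {Y : ℝ → ℝ × ℝ} (h : IsStationaryFront V L um up u) (hL : 0 < L)
    (hY : IsIntegralCurveOn Y (fun x => newtonField fun w => deriv (deriv V.Vm) (u x) * w)
      (Icc (-L) L)) :
    symplecticForm (newtonField (deriv V.Vm) (phasePoint u L)) (Y L) =
      symplecticForm (newtonField (deriv V.Vm) (phasePoint u (-L))) (Y (-L)) := by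
  have hX := h.isIntegralCurveOn_phasePoint hL
  have hd : ∀ x ∈ Icc (-L) L, HasDerivWithinAt
      (fun x => symplecticForm (newtonField (deriv V.Vm) (phasePoint u x)) (Y x)) 0
      (Icc (-L) L) x := fun x hx => by
    have hforce := (V.contDiff_deriv_Vm.differentiable two_ne_zero (u x)).hasDerivAt
      |>.comp_hasDerivWithinAt x (hX x hx).fst
    have hfield : HasDerivWithinAt (fun x => newtonField (deriv V.Vm) (phasePoint u x))
        (-deriv V.Vm (u x), -(deriv (deriv V.Vm) (u x) * deriv u x)) (Icc (-L) L) x :=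
      HasDerivWithinAt.prodMk (hX x hx).snd hforce.neg
    refine (hasDerivWithinAt_symplecticForm hfield (hY x hx)).congr_deriv ?_
    simp only [symplecticForm, newtonField, phasePoint]
    ring
  exact constant_of_derivWithin_zero (fun x hx => (hd x hx).differentiableWithinAt)
    (fun x hx => (hd x (Ico_subset_Icc_self hx)).derivWithin
      (uniqueDiffOn_Icc (by linarith) x (Ico_subset_Icc_self hx))) L
    (right_mem_Icc.2 (by linarith))

namespace IsLengthCurve

variable {V : PiecewisePotential} {um up g : ℝ} {G : Set ℝ} {L : ℝ → ℝ} {uf : ℝ → ℝ → ℝ}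

theorem phaseEnergy_middle (h : IsLengthCurve V um up G L uf) (hg : g ∈ G) {x : ℝ}
    (hx : x ∈ Icc (-(L g)) (L g)) : phaseEnergy V.Vm (phasePoint (uf g) x) = g := by
  have hu := (h.front g hg).continuous
  have hp := (h.front g hg).continuous_deriv
  have hV := V.contDiff_m.continuous
  rw [← closure_Ioo (by linarith [h.pos g hg])] at hx
  exact closure_minimal (h.hamiltonian g hg)
    (isClosed_eq (f := fun x => deriv (uf g) x ^ 2 / 2 + V.Vm (uf g x)) (by fun_prop)
      continuous_const) hx

theorem hasDerivAt_phasePoint_left (h : IsLengthCurve V um up G L uf) (hg : g ∈ G)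
    (hBl : bifLeft V (L g) (uf g) ≠ 0) :
    HasDerivAt (fun y => phasePoint (uf y) (-(L y)))
      ((bifLeft V (L g) (uf g))⁻¹ • newtonField (deriv V.Vl) (phasePoint (uf g) (-(L g)))) g := by
  have hG : ∀ᶠ y in 𝓝 g, y ∈ G := h.isOpen.mem_nhds hg
  exact hasDerivAt_of_phaseEnergy_eq
    ((h.continuousOn_ul.continuousAt hG).prodMk (h.continuousOn_pl.continuousAt hG))
    (V.contDiff_l.differentiable three_ne_zero _).hasDerivAt
    (V.contDiff_m.differentiable three_ne_zero _).hasDerivAt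
    (hG.mono fun y hy => (h.front y hy).phaseEnergy_left (h.pos y hy))
    (hG.mono fun y hy => h.phaseEnergy_middle hy (left_mem_Icc.2 (by linarith [h.pos y hy]))) hBl

theorem hasDerivAt_phasePoint_right (h : IsLengthCurve V um up G L uf) (hg : g ∈ G)
    (hBr : bifRight V (L g) (uf g) ≠ 0) :
    HasDerivAt (fun y => phasePoint (uf y) (L y))
      (-(bifRight V (L g) (uf g))⁻¹ • newtonField (deriv V.Vr) (phasePoint (uf g) (L g))) g := by
  have hG : ∀ᶠ y in 𝓝 g, y ∈ G := h.isOpen.mem_nhds hg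
  have hneg : deriv (uf g) (L g) * (deriv V.Vm (uf g (L g)) - deriv V.Vr (uf g (L g))) =
      -bifRight V (L g) (uf g) := by rw [bifRight, ← mul_neg, neg_sub]
  rw [← inv_neg, ← hneg]
  exact hasDerivAt_of_phaseEnergy_eq
    ((h.continuousOn_ur.continuousAt hG).prodMk (h.continuousOn_pr.continuousAt hG))
    (V.contDiff_r.differentiable three_ne_zero _).hasDerivAt
    (V.contDiff_m.differentiable three_ne_zero _).hasDerivAt
    (hG.mono fun y hy => (h.front y hy).phaseEnergy_right (h.pos y hy))
    (hG.mono fun y hy => h.phaseEnergy_middle hy (right_mem_Icc.2 (by linarith [h.pos y hy])))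
    (hneg ▸ neg_ne_zero.2 hBr)

theorem symplecticForm_middle_variation_eq (h : IsLengthCurve V um up G L uf) (hg : g ∈ G)
    (hL' : deriv L g ≠ 0) {Y : ℝ → ℝ × ℝ} {D₀ D₁ : ℝ × ℝ}
    (hY : IsIntegralCurveOn Y (fun x => newtonField fun w => deriv (deriv V.Vm) (uf g x) * w)
      (Icc (-(L g)) (L g)))
    (hD₀ : HasDerivAt (fun y => phasePoint (uf y) (-(L y))) D₀ g)
    (hD₁ : HasDerivAt (fun y => phasePoint (uf y) (L y)) D₁ g) :
    symplecticForm (D₁ - (deriv L g + deriv L g) •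
        newtonField (deriv V.Vm) (phasePoint (uf g) (L g))) (Y (L g)) =
      symplecticForm D₀ (Y (-(L g))) := by
  have hG : ∀ᶠ y in 𝓝 g, y ∈ G := h.isOpen.mem_nhds hg
  have hLd : HasDerivAt L (deriv L g) g :=
    ((h.contDiffOn.contDiffAt hG).differentiableAt one_ne_zero).hasDerivAt
  have hZ : ∀ᶠ y in 𝓝 g, IsIntegralCurveOn (fun t => phasePoint (uf y) (t - L y))
      (fun _ => newtonField (deriv V.Vm)) (Icc 0 (L y + L y)) := hG.mono fun y hy => by
    simpa only [neg_add_cancel] using isIntegralCurveOn_comp_sub_Icc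
      ((h.front y hy).isIntegralCurveOn_phasePoint (h.pos y hy)) (L y)
  have hY' := isIntegralCurveOn_comp_sub_Icc hY (L g)
  rw [neg_add_cancel] at hY'
  have hvar := symplecticForm_endpoint_variation_eq (T := fun y => L y + L y)
    V.contDiff_deriv_Vm hZ hY' (by linarith [h.pos g hg]) (hLd.add hLd)
    (by rwa [← two_mul, mul_ne_zero_iff_left two_ne_zero]) (by simpa only [zero_sub] using hD₀)
    (by simpa only [add_sub_cancel_right] using hD₁)
  simpa only [zero_sub, add_sub_cancel_right] using hvar

/- Continue `u_x` from the left interval as a solution `Y` of the linearised equation. Both this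
solution and the variation of the fronts along the curve are tangent to the orbit of `um` at
`-L`, so that the right-hand side of the variation identity vanishes. -/
theorem symplecticForm_continuation_eq (h : IsLengthCurve V um up G L uf) (hg : g ∈ G)
    (hBl : bifLeft V (L g) (uf g) ≠ 0) (hBr : bifRight V (L g) (uf g) ≠ 0)
    (hL' : deriv L g ≠ 0) {Y : ℝ → ℝ × ℝ}
    (hY : IsIntegralCurveOn Y (fun x => newtonField fun w => deriv (deriv V.Vm) (uf g x) * w)
      (Icc (-(L g)) (L g)))
    (hYl : Y (-(L g)) = newtonField (deriv V.Vl) (phasePoint (uf g) (-(L g)))) :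
    symplecticForm (newtonField (deriv V.Vr) (phasePoint (uf g) (L g))) (Y (L g)) =
      -(2 * deriv L g * bifLeft V (L g) (uf g) * bifRight V (L g) (uf g)) := by
  have hvar := h.symplecticForm_middle_variation_eq hg hL' hY
    (h.hasDerivAt_phasePoint_left hg hBl) (h.hasDerivAt_phasePoint_right hg hBr)
  have hmid : symplecticForm (newtonField (deriv V.Vm) (phasePoint (uf g) (L g))) (Y (L g)) =
      bifLeft V (L g) (uf g) := by
    rw [(h.front g hg).symplecticForm_newtonField_eq (h.pos g hg) hY, hYl]
    simp only [symplecticForm, newtonField, phasePoint, bifLeft]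
    ring
  rw [symplecticForm_smul_sub_smul, hmid, hYl, symplecticForm_smul_self] at hvar
  field_simp at hvar
  linear_combination -hvar

end IsLengthCurve

theorem exists_signs_of_asymptoticSign_ne_zero {u : ℝ → ℝ} (hu : Continuous (deriv u))
    (h : asymptoticSign u ≠ 0) :
    ∃ σ τ : ℝ, (∀ᶠ x in atTop, 0 < σ * deriv u x) ∧ (∀ᶠ x in atTop, 0 < τ * deriv u (-x)) ∧
      τ * τ = 1 ∧ asymptoticSign u = σ * τ := by
  have hne : ∀ᶠ x in atTop, deriv u x * deriv u (-x) ≠ 0 := by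
    unfold asymptoticSign at h
    split_ifs at h with hsame hopp
    · exact hsame.mono fun x hx => hx.ne'
    · exact hopp.mono fun x hx => hx.ne
    · exact absurd rfl h
  obtain ⟨σ, hσ, hσpos⟩ := exists_sign_eventually_pos hu (hne.mono fun x => left_ne_zero_of_mul)
  obtain ⟨τ, hτ, hτpos⟩ := exists_sign_eventually_pos (hu.comp continuous_neg)
    (hne.mono fun x => right_ne_zero_of_mul)
  have hprod : ∀ᶠ x in atTop, 0 < σ * τ * (deriv u x * deriv u (-x)) := by
    filter_upwards [hσpos, hτpos] with x hx hx'
    rw [mul_mul_mul_comm]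
    exact mul_pos hx hx'
  have hsign : asymptoticSign u = σ * τ := by
    have hdichotomy : σ * τ = 1 ∨ σ * τ = -1 := by
      rcases hσ with rfl | rfl <;> rcases hτ with rfl | rfl <;> norm_num
    rcases hdichotomy with hone | hone <;> rw [hone] at hprod ⊢
    · exact if_pos (hprod.mono fun x hx => by rwa [one_mul] at hx)
    · have hopp : ∀ᶠ x in atTop, deriv u x * deriv u (-x) < 0 :=
        hprod.mono fun x hx => by linarith
      have hnot : ¬ ∀ᶠ x in atTop, 0 < deriv u x * deriv u (-x) := fun hsame => by
        obtain ⟨x, hx, hx'⟩ := (hsame.and hopp).exists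
        exact lt_asymm hx hx'
      rw [asymptoticSign, if_neg hnot, if_pos hopp]
  exact ⟨σ, τ, hσpos, hτpos, by rcases hτ with rfl | rfl <;> norm_num, hsign⟩

theorem neg_notMem_pair_neg {a x : ℝ} (hx : x ∉ ({-a, a} : Set ℝ)) : -x ∉ ({-a, a} : Set ℝ) := by
  simp only [mem_insert_iff, mem_singleton_iff, not_or, neg_eq_iff_eq_neg, neg_neg] at hx ⊢
  exact ⟨hx.2, hx.1⟩

theorem IsStationaryFront.isIntegralCurveOn_reflected_jost {V : PiecewisePotential} {L um up : ℝ}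
    {u : ℝ → ℝ} {k k' : ℝ → ℝ → ℝ} (h : IsStationaryFront V L um up u) (hL : 0 < L)
    (hk : IsJostFamily (fun x => V.duu L (u (-x)) (-x)) {-L, L} k k') (c : ℝ) :
    IsIntegralCurveOn (fun x => (c * k 0 (-x), -(c * k' 0 (-x))))
      (fun x => newtonField fun w => deriv (deriv V.Vm) (u x) * w) (Icc (-L) L) := by
  have hkc := hk.continuous le_rfl
  have hkc' := hk.continuous_deriv 0 le_rfl
  have hu := h.continuous
  have hV : Continuous (deriv (deriv V.Vm)) :=
    (contDiff_deriv_deriv (n := 1) V.contDiff_m).continuous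
  have hode : ∀ x ∈ Ioo (-L) L, HasDerivAt (fun x => -(c * k' 0 (-x)))
      (-(deriv (deriv V.Vm) (u x) * (c * k 0 (-x)))) x := fun x hx => by
    have hx' : x ∉ ({-L, L} : Set ℝ) := by
      simp only [mem_insert_iff, mem_singleton_iff, not_or]
      exact ⟨hx.1.ne', hx.2.ne⟩
    refine ((hasDerivAt_comp_neg (hk.ode 0 le_rfl (-x) (neg_notMem_pair_neg hx'))).const_mul
      c).neg.congr_deriv ?_
    rw [neg_neg, V.duu_middle _ hx.1.le hx.2.le]
    ring
  exact fun x hx => HasDerivWithinAt.prodMk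
    (((hasDerivAt_comp_neg (hk.hasDerivAt 0 le_rfl (-x))).const_mul c).congr_deriv
      (mul_neg _ _)).hasDerivWithinAt
    (hasDerivWithinAt_Icc_of_hasDerivAt_Ioo (by linarith) (by fun_prop) (by fun_prop) hode hx)

theorem IsLengthCurve.exists_isJostFamily_jostWronskian_pos {V : PiecewisePotential} {um up : ℝ}
    {G : Set ℝ} {L : ℝ → ℝ} {uf : ℝ → ℝ → ℝ} (h : IsLengthCurve V um up G L uf) {g : ℝ} (hg : g ∈ G)
    (hpos : 0 < asymptoticSign (uf g) * bifLeft V (L g) (uf g) * bifRight V (L g) (uf g)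
      * deriv L g) :
    ∃ f f' k k' : ℝ → ℝ → ℝ,
      IsJostFamily (fun x => V.duu (L g) (uf g x) x) {-(L g), L g} f f' ∧
      IsJostFamily (fun x => V.duu (L g) (uf g (-x)) (-x)) {-(L g), L g} k k' ∧
      0 < jostWronskian f f' k k' 0 (L g) := by
  have hf := h.front g hg
  have hL := h.pos g hg
  have hne := hpos.ne'
  simp only [mul_ne_zero_iff] at hne
  obtain ⟨⟨⟨hsign, hBl⟩, hBr⟩, hL'⟩ := hne
  obtain ⟨σ, τ, hσ, hτ, hτsq, hστ⟩ := exists_signs_of_asymptoticSign_ne_zero hf.continuous_deriv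
    hsign
  obtain ⟨f, f', hjf, c, hc, hc₁, hc₂⟩ := hf.exists_isJostFamily hL hσ
  obtain ⟨k, k', hjk, d, hd, hd₁, hd₂⟩ := hf.exists_isJostFamily_reflect hL hτ
  have hcont := h.symplecticForm_continuation_eq hg hBl hBr hL'
    (hf.isIntegralCurveOn_reflected_jost hL hjk (τ * d)) (by
      simp only [newtonField, phasePoint, neg_neg, Prod.mk.injEq, neg_inj, mul_assoc, ← hd₁, ← hd₂]
      simp only [← mul_assoc, hτsq, one_mul, and_self])
  have hW : c * d * jostWronskian f f' k k' 0 (L g) =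
      2 * (asymptoticSign (uf g) * bifLeft V (L g) (uf g) * bifRight V (L g) (uf g) *
        deriv L g) := by
    simp only [symplecticForm, newtonField, phasePoint] at hcont
    rw [hστ, jostWronskian]
    linear_combination -(d * k 0 (-(L g))) * hc₂ - (d * k' 0 (-(L g))) * hc₁ - σ * τ * hcont -
      d * σ * (k' 0 (-(L g)) * deriv (uf g) (L g) - k 0 (-(L g)) * deriv V.Vr (uf g (L g))) * hτsq
  refine ⟨f, f', k, k', hjf, hjk, (mul_pos_iff_of_pos_left (mul_pos hc hd)).1 ?_⟩
  rw [hW]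
  positivity

theorem theorem3_general (V : PiecewisePotential) (um up : ℝ) (G : Set ℝ) (L : ℝ → ℝ)
    (uf : ℝ → ℝ → ℝ) (hcurve : IsLengthCurve V um up G L uf) (g : ℝ) (hg : g ∈ G)
    (hpos : 0 < asymptoticSign (uf g) * bifLeft V (L g) (uf g) * bifRight V (L g) (uf g)
      * deriv L g) :
    ∃ Λ : ℝ, 0 < Λ ∧ IsLinearisationEigenvalue V (L g) (uf g) Λ := by
  obtain ⟨f, f', k, k', hf, hk, hW⟩ := hcurve.exists_isJostFamily_jostWronskian_pos hg hpos
  obtain ⟨K, hK⟩ := (hcurve.front g hg).exists_abs_duu_le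
  have hsymm : ∀ x ∉ ({-(L g), L g} : Set ℝ), -x ∉ ({-(L g), L g} : Set ℝ) := fun _ =>
    neg_notMem_pair_neg
  rw [hf.jostWronskian_eq hk (Set.to_countable _) hsymm le_rfl (L g) 0] at hW
  exact hf.exists_pos_isSchrodingerEigenvalue hk (Set.to_countable _) hsymm
    (hcurve.front g hg).measurable_duu hK hW

end

theorem theorem3 (V : PiecewisePotential) (um up : ℝ) (G : Set ℝ) (L : ℝ → ℝ) (uf : ℝ → ℝ → ℝ)
    (hcurve : IsLengthCurve V um up G L uf) (g : ℝ) (hg : g ∈ G)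
    (hsimple : HasSimpleDerivZeros (L g) (uf g))
    (hpos : 0 < asymptoticSign (uf g) * bifLeft V (L g) (uf g) * bifRight V (L g) (uf g)
      * deriv L g) :
    ∃ Λ : ℝ, 0 < Λ ∧ IsLinearisationEigenvalue V (L g) (uf g) Λ :=
  theorem3_general V um up G L uf hcurve g hg hpos
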